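/- Let $k$ be a field of characteristic zero and let $s,n\in\mathbb N$. Let $W$ be the set of non-empty words $w$ of length $|w|\le n$ over the alphabet $\{1,\dots,s\}$, put $\deg(w):=|w|$ and $N:=\#W$, and index the coordinates of $k^N$ by $W$. A point $f\in k^N$ is regarded as a unital linear functional on $k\langle x_1,\dots,x_s\rangle$ through $f(1)=1$ and $f(x_w)=f_w$ for $w\in W$ (the values on longer words play no role below). Write a word $u$ in the letters $x_1,\dots,x_s,y_1,\dots,y_s$ as $u=v_1\cdots v_m$, where the $v_i$ are non-empty words, alternately in the $x$'s only ($\epsilon_i=1$) and in the $y$'s only ($\epsilon_i=2$). For functionals $f,g$ put $\varphi_{\epsilon_i}:=f$ if $\epsilon_i=1$ and $\varphi_{\epsilon_i}:=g$ if $\epsilon_i=2$ (in the latter case each $y_j$ is read as $x_j$). The tensor, boolean and free products of $f$ and $g$ are the linear functionals on $k\langle x_1,\dots,x_s,y_1,\dots,y_s\rangle$ with $$(f\bullet_{\mathrm T}g)(u)=f\Big(\prod_{\epsilon_i=1}v_i\Big)\,g\Big(\prod_{\epsilon_i=2}v_i\Big),\qquad (f\bullet_{\mathrm B}g)(u)=\prod_{\epsilon_i=1}f(v_i)\prod_{\epsilon_i=2}g(v_i),$$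 $$(f\bullet_{\mathrm F}g)(u)=\sum_{I\subsetneq\{1,\dots,m\}}(-1)^{m-|I|+1}\,(f\bullet_{\mathrm F}g)\Big(\prod_{i\in I}v_i\Big)\prod_{i\notin I}\varphi_{\epsilon_i}(v_i)\quad(m\ge1),$$ and with value $1$ on the empty word. Let $\Delta_a:k\langle x_1,\dots,x_s\rangle\to k\langle x_1,\dots,x_s,y_1,\dots,y_s\rangle$ be the unital algebra morphism with $\Delta_a(x_i)=x_i+y_i$. For $\bullet\in\{\mathrm T,\mathrm F,\mathrm B\}$ let $(f\star_{\bullet,a}g)_w:=\big((f\bullet g)\circ\Delta_a\big)(x_w)$ for $w\in W$, a binary operation on $k^N$. Over any commutative $k$-algebra the same formulas apply; let $F_\bullet(X,Y)=X\star_{\bullet,a}Y$ for two families of commuting variables $X=(X_w)_{w\in W}$, $Y=(Y_w)_{w\in W}$, so that $F_\bullet(X,Y)_w\in k[X,Y]$. Give $X_w$ and $Y_w$ the degree $\deg(w)$. For $v\in k^N$ consider curves $\gamma\in k[t]^N$ with $\gamma(0)=0$ and $\gamma'_w(t)=\sum_{u\in W} v_u\,\frac{\partial F_{\bullet}(X,Y)_w}{\partial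 Y_u}\big|_{X=\gamma(t),\,Y=0}$ for all $w\in W$, i.e. integral curves from the origin of the left-invariant vector field with coordinates $v$ in the Jacobian basis. Put $\operatorname{EXP}_\bullet(v):=\gamma(1)$, and let $\operatorname{LOG}_\bullet$ be the inverse map of $\operatorname{EXP}_\bullet$. The following hold. 1. For each $\bullet\in\{\mathrm T,\mathrm F,\mathrm B\}$, $(k^N,\star_{\bullet,a},0)$ is an abelian group whose law is given by the polynomials $F_\bullet(X,Y)_w$, that is $(f\star_{\bullet,a}g)_w=F_\bullet(f,g)_w$, and $F_\bullet(X,Y)_w$ is homogeneous of degree $\deg(w)$. The group is homogeneous with weights $\sigma_w=\deg(w)$: these are positive integers, and for every $\lambda\in k\setminus\{0\}$ the scaling $(f_w)_w\mapsto(\lambda^{\deg(w)}f_w)_w$ is an automorphism of it. 2. For every $v\in k^N$ there is exactly one such curve $\gamma$. The map $\operatorname{EXP}_\bullet$ is bijective, so that $\operatorname{LOG}_\bullet$ is well defined, and $$\operatorname{LOG}_\bullet:(k^N,\star_{\bullet,a},0)\to(k^N,+,0),\qquad \operatorname{EXP}_\bullet:(k^N,+,0)\to(k^N,\star_{\bullet,a},0)$$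 are mutually inverse group isomorphisms. Both are given by polynomials whose component at $w$ is homogeneous of degree $\deg(w)$. 3. For all $i,j\in\{\mathrm T,\mathrm F,\mathrm B\}$ the map $\operatorname{EXP}_j\circ\operatorname{LOG}_i$ is a group isomorphism $(k^N,\star_{i,a},0)\to(k^N,\star_{j,a},0)$, it is given by polynomials whose component at $w$ is homogeneous of degree $\deg(w)$, and $\operatorname{LOG}_j\circ(\operatorname{EXP}_j\circ\operatorname{LOG}_i)=\operatorname{LOG}_i$. -/

import Mathlib

namespace MomentConvolution

/-! ### Words and truncated series -/

/-- The words `w` over `s` letters with `1 ≤ |w| ≤ n`; they index the coordinates of `k^N`. -/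
abbrev Word (s n : ℕ) : Type :=
  {w : List (Fin s) // w ≠ [] ∧ w.length ≤ n}

instance (s n : ℕ) : Finite (Word s n) :=
  ((List.finite_length_le (Fin s) n).subset (fun _ h => h.2)).to_subtype

noncomputable instance (s n : ℕ) : Fintype (Word s n) := Fintype.ofFinite _

/-- The degree `deg w = |w|`. -/
def deg {s n : ℕ} (w : Word s n) : ℕ := w.1.length

/-- A point of `R^N`, seen as (the coefficients of) a functional on noncommutative polynomials:
the empty word has value `1`, the words longer than the truncation have value `0`. The latter
value is immaterial: the coefficient at `w` of a convolution involves only words of length at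
most `|w|`. -/
def extend {R : Type*} [CommRing R] {s n : ℕ} (f : Word s n → R) (w : List (Fin s)) : R :=
  if w = [] then 1 else if h : w ≠ [] ∧ w.length ≤ n then f ⟨w, h⟩ else 0

/-! ### Universal products

`Sum.inl i` is the letter `x_i`, `Sum.inr i` the letter `y_i`; a functional on noncommutative
polynomials is given by its values on words. -/

/-- `u|x`: the subword of the letters `x_i`. -/
def xPart {α : Type*} (u : List (α ⊕ α)) : List α := u.filterMap Sum.getLeft?

/-- `u|y`: the subword of the letters `y_i`. -/
def yPart {α : Type*} (u : List (α ⊕ α)) : List α := u.filterMap Sum.getRight?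

/-- The alternating decomposition `u = v₁ ⋯ v_m` into maximal blocks of letters of one kind. -/
def blocks {α : Type*} (u : List (α ⊕ α)) : List (List (α ⊕ α)) :=
  u.splitBy (fun a b => a.isLeft == b.isLeft)

/-- The value on a block: that of `f` on a word in the `x_i`, that of `g` on a word
in the `y_i`. -/
def blockValue {R α : Type*} [CommRing R] (f g : List α → R) : List (α ⊕ α) → R
  | [] => 1
  | Sum.inl i :: v => f (xPart (Sum.inl i :: v))
  | Sum.inr i :: v => g (yPart (Sum.inr i :: v))

/-- The subword `∏_{i ∈ I} v_i` of `u = v₁ ⋯ v_m`, in the original order. -/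
def subword {α : Type*} (u : List (α ⊕ α)) (I : Finset (Fin (blocks u).length)) :
    List (α ⊕ α) :=
  ((List.finRange (blocks u).length).filter (fun i => i ∈ I)).flatMap (fun i => (blocks u).get i)

theorem subword_length_lt {α : Type*} (u : List (α ⊕ α))
    (I : Finset (Fin (blocks u).length)) (hI : I ≠ Finset.univ) :
    (subword u I).length < u.length := by
  classical
  have hu : u.length = ∑ i : Fin (blocks u).length, ((blocks u).get i).length := by
    conv_lhs => rw [← List.flatten_splitBy (fun a b => a.isLeft == b.isLeft) u]
    rw [List.length_flatten]
    exact (Fin.sum_univ_fun_getElem (blocks u) List.length).symm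
  have hs : (subword u I).length = ∑ i ∈ I, ((blocks u).get i).length := by
    unfold subword
    rw [List.length_flatMap]
    rw [← List.sum_toFinset _ ((List.nodup_finRange _).filter _)]
    congr 1
    ext i
    simp
  rw [hu, hs]
  obtain ⟨j, hj⟩ : ∃ j, j ∉ I := by
    by_contra h
    push Not at h
    exact hI (Finset.eq_univ_iff_forall.2 h)
  refine Finset.sum_lt_sum_of_subset (Finset.subset_univ I) (Finset.mem_univ j) hj ?_
    (fun _ _ _ => Nat.zero_le _)
  exact List.length_pos_of_ne_nil (List.ne_nil_of_mem_splitBy (List.get_mem (blocks u) j))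

/-- The tensor product `(f •_T g)(v₁ ⋯ v_m) = f(∏_{ε_i = 1} v_i) g(∏_{ε_i = 2} v_i)`. -/
def tensorValue {R α : Type*} [CommRing R] (f g : List α → R) (u : List (α ⊕ α)) : R :=
  f (xPart u) * g (yPart u)

/-- The boolean product `(f •_B g)(v₁ ⋯ v_m) = ∏_{ε_i = 1} f(v_i) ∏_{ε_i = 2} g(v_i)`. -/
def booleanValue {R α : Type*} [CommRing R] (f g : List α → R) (u : List (α ⊕ α)) : R :=
  ((blocks u).map (blockValue f g)).prod

/-- The free product, recursively: its value is `1` on the empty word, and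
`(f •_F g)(v₁ ⋯ v_m) = ∑_{I ⊊ {1, …, m}} (-1)^(m - |I| + 1) (f •_F g)(∏_{i ∈ I} v_i)
∏_{i ∉ I} φ_{ε_i}(v_i)`. -/
def freeValue {R α : Type*} [CommRing R] (f g : List α → R) (u : List (α ⊕ α)) : R :=
  if u = [] then 1
  else ∑ I : {I : Finset (Fin (blocks u).length) // I ≠ Finset.univ},
    (-1) ^ ((blocks u).length - I.1.card + 1) * freeValue f g (subword u I.1) *
      ∏ i ∈ I.1ᶜ, blockValue f g ((blocks u).get i)
termination_by u.length
decreasing_by exact subword_length_lt u I.1 I.2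

/-- Tensor, free and boolean independence. -/
inductive Independence
  | tensor
  | free
  | boolean

/-- The values of the universal product `f • g` on words in the letters `x_i`, `y_i`. -/
def wordValue {R α : Type*} [CommRing R] (f g : List α → R) :
    Independence → List (α ⊕ α) → R
  | .tensor => tensorValue f g
  | .free => freeValue f g
  | .boolean => booleanValue f g

/-- The universal product `f • g`, a linear functional on `R⟨x_1, …, x_s, y_1, …, y_s⟩`. -/
noncomputable def universalProduct {R : Type*} [CommRing R] (ι : Independence) {s : ℕ}
    (f g : List (Fin s) → R) : FreeAlgebra R (Fin s ⊕ Fin s) →ₗ[R] R :=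
  (FreeAlgebra.basisFreeMonoid R (Fin s ⊕ Fin s)).constr R
    (fun u => wordValue f g ι (FreeMonoid.toList u))

/-- The additive coproduct `Δ_a(x_i) = x_i + y_i`, an algebra morphism. -/
noncomputable def addCoproduct (R : Type*) [CommRing R] (s : ℕ) :
    FreeAlgebra R (Fin s) →ₐ[R] FreeAlgebra R (Fin s ⊕ Fin s) :=
  FreeAlgebra.lift R (fun i => FreeAlgebra.ι R (Sum.inl i) + FreeAlgebra.ι R (Sum.inr i))

/-- The monomial `x_w`. -/
noncomputable def monomialOf (R : Type*) [CommRing R] {s : ℕ} (w : List (Fin s)) :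
    FreeAlgebra R (Fin s) :=
  (w.map (FreeAlgebra.ι R)).prod

/-- The additive convolution `f ⋆ g = (f • g) ∘ Δ_a` on `R^N`. -/
noncomputable def conv {R : Type*} [CommRing R] (ι : Independence) {s n : ℕ}
    (f g : Word s n → R) : Word s n → R :=
  fun w => universalProduct ι (extend f) (extend g) (addCoproduct R s (monomialOf R w.1))

/-- The polynomial group law `F(X, Y)`: the convolution of two generic points, where
`X_w` is the variable `Sum.inl w` and `Y_w` is the variable `Sum.inr w`. -/
noncomputable def groupLaw (k : Type*) [Field k] (ι : Independence) (s n : ℕ) :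
    Word s n → MvPolynomial (Word s n ⊕ Word s n) k :=
  conv ι (fun w => MvPolynomial.X (Sum.inl w)) (fun w => MvPolynomial.X (Sum.inr w))

/-! ### Groups, homogeneity, exponential and logarithm -/

/-- `(G, op, e)` is an abelian group. -/
structure IsAbelianGroup {G : Type*} (op : G → G → G) (e : G) : Prop where
  assoc : ∀ x y z, op (op x y) z = op x (op y z)
  comm : ∀ x y, op x y = op y x
  unit : ∀ x, op x e = x
  inverse : ∀ x, ∃ y, op x y = e

/-- `φ` is an isomorphism from `(G, op₁)` onto `(H, op₂)`. -/
def IsGroupIso {G H : Type*} (op₁ : G → G → G) (op₂ : H → H → H) (φ : G → H) : Prop :=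
  Function.Bijective φ ∧ ∀ x y, φ (op₁ x y) = op₂ (φ x) (φ y)

/-- The group `(k^W, op)` is homogeneous with the weights `σ`: these are positive integers, and
every scaling `δ_λ(x)_w = λ^{σ_w} x_w` with `λ ≠ 0` is an automorphism. -/
def IsHomogeneousGroup {k W : Type*} [Field k] (σ : W → ℕ)
    (op : (W → k) → (W → k) → W → k) : Prop :=
  (∀ w, 1 ≤ σ w) ∧ ∀ c : k, c ≠ 0 → IsGroupIso op op (fun x w => c ^ σ w * x w)

/-- `φ` is given by polynomials, the one at `w` being homogeneous of degree `σ w` when the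
variable `X_u` has degree `σ u`. -/
def IsHomogeneousPolynomialMap {k W : Type*} [Field k] (σ : W → ℕ)
    (φ : (W → k) → W → k) : Prop :=
  ∃ P : W → MvPolynomial W k, (∀ w, MvPolynomial.IsWeightedHomogeneous σ (P w) (σ w)) ∧
    ∀ x w, φ x w = MvPolynomial.eval x (P w)

/-- The entries `(∂F_w / ∂Y_u)(X, 0)` of the Jacobian matrix at the origin of the left
translation by `X`. Its columns, indexed by `u`, are the left-invariant vector fields that form
the Jacobian basis of the Lie algebra. -/
noncomputable def jacobian {k W : Type*} [Field k] (F : W → MvPolynomial (W ⊕ W) k) (w u : W) :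
    MvPolynomial W k :=
  MvPolynomial.aeval (Sum.elim MvPolynomial.X (fun _ => 0)) (MvPolynomial.pderiv (Sum.inr u) (F w))

/-- The polynomial curve `γ` starts at the origin and is an integral curve of the left-invariant
vector field with coordinates `v` in the Jacobian basis. -/
def IsIntegralCurve {k W : Type*} [Field k] [Fintype W] (F : W → MvPolynomial (W ⊕ W) k)
    (v : W → k) (γ : W → Polynomial k) : Prop :=
  (∀ w, (γ w).eval 0 = 0) ∧
    ∀ w, Polynomial.derivative (γ w) =
      ∑ u, Polynomial.C (v u) * MvPolynomial.aeval γ (jacobian F w u)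

open Classical in
/-- The exponential map in the coordinates of the Jacobian basis: the value at time `1` of the
integral curve that starts at the origin. -/
noncomputable def expMap {k W : Type*} [Field k] [Fintype W] (F : W → MvPolynomial (W ⊕ W) k)
    (v : W → k) : W → k :=
  if h : ∃ γ, IsIntegralCurve F v γ then fun w => (h.choose w).eval 1 else 0

/-- The logarithm, as the inverse function of the exponential map. -/
noncomputable def logMap {k W : Type*} [Field k] [Fintype W] (F : W → MvPolynomial (W ⊕ W) k) :
    (W → k) → W → k :=
  Function.invFun (expMap F)

/-- `EXP` for the additive convolution group of the independence `ι`. -/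
noncomputable def EXP {k : Type*} [Field k] (ι : Independence) {s n : ℕ} :
    (Word s n → k) → Word s n → k :=
  expMap (groupLaw k ι s n)

/-- `LOG` for the additive convolution group of the independence `ι`. -/
noncomputable def LOG {k : Type*} [Field k] (ι : Independence) {s n : ℕ} :
    (Word s n → k) → Word s n → k :=
  logMap (groupLaw k ι s n)

end MomentConvolution

namespace MomentConvolution

/-! ### Triangular maps -/

/-! The argument has two independent halves. The first shows that the three convolutions are
commutative, associative and unital, natural in the ring and graded by word length. The second
concerns an arbitrary commutative polynomial law that is weighted homogeneous with positive weights
(`IsHomogeneousLaw`), and gives the exponential and logarithm with all their properties.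

For the tensor product, removing the first letter obeys a Leibniz rule (`wordConv_tensor_cons`), and
induction on the word suffices. The free and boolean products are linearized by cumulants. A word is
read letter by letter on a state `c`, where `c w` is the weight carried when the positions still
awaited in the open blocks are filled by the letters of `w`. A letter fills the next awaited
position or opens a new block. With the Cauchy product, a new block must be completed before the
older ones resume, as in noncrossing partitions; with `outer`, a block opens only when none is open,
as in interval partitions. Every normalized functional has cumulants (`exists_moments_eq`), the free
and boolean products are those whose mixed cumulants vanish (`freeValue_moments`,
`booleanValue_moments`), and summing over colourings adds cumulants (`colorSum_moments`).
Convolution thus becomes addition.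

In the second half, homogeneity and positivity make the Jacobian matrix unipotent triangular
(`IsHomogeneousLaw.aeval_jacobian_congr`, `IsHomogeneousLaw.aeval_jacobian_of_le`). The Picard
operator is therefore strictly triangular, so it has exactly one fixed point, the integral curve.
The exponential is the identity plus a strictly triangular remainder, hence invertible by the same
fixed-point principle. Performing both constructions over `k[X]` and specializing gives polynomial
formulas. Finally, differentiated associativity and commutativity show that the product of the
curves for `u` and `v` is the curve for `u + v` (`IsHomogeneousLaw.isIntegralCurve_polyOp`);
uniqueness and evaluation at time 1 make the exponential a homomorphism. -/

/-- `Φ` is strictly triangular for the degree `σ`: the value of `Φ x` at `w` depends only on the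
values of `x` in degrees below that of `w`. -/
def IsTriangular {W A B : Type*} (σ : W → ℕ) (Φ : (W → A) → W → B) : Prop :=
  ∀ x y w, (∀ u, σ u < σ w → x u = y u) → Φ x w = Φ y w

theorem IsTriangular.eq_of_fixed {W A : Type*} {σ : W → ℕ} {Φ : (W → A) → W → A}
    (h : IsTriangular σ Φ) {x y : W → A} (hx : Φ x = x) (hy : Φ y = y) : x = y := by
  have key : ∀ d w, σ w = d → x w = y w := by
    intro d
    induction d using Nat.strong_induction_on with
    | _ d ih =>
      intro w hw
      rw [← hx, ← hy]
      exact h x y w (fun u hu => ih _ (hw ▸ hu) u rfl)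
  exact funext fun w => key _ w rfl

/-- The fixed point of a strictly triangular map, by iteration from `x₀`. -/
def triangularFix {W A : Type*} (σ : W → ℕ) (Φ : (W → A) → W → A) (x₀ : W → A) : W → A :=
  fun w => (Φ^[σ w + 1] x₀) w

/-- Each iteration settles one further degree, whatever the starting point. -/
theorem IsTriangular.iterate_succ {W A : Type*} {σ : W → ℕ} {Φ : (W → A) → W → A}
    (h : IsTriangular σ Φ) (x₀ : W → A) (m : ℕ) :
    ∀ w, σ w < m → (Φ^[m + 1] x₀) w = (Φ^[m] x₀) w := by
  induction m with
  | zero => intro w hw; omega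
  | succ m ih =>
    intro w hw
    rw [Function.iterate_succ_apply' Φ (m + 1), Function.iterate_succ_apply' Φ m]
    refine h _ _ _ fun u hu => ?_
    rw [← Function.iterate_succ_apply' Φ m]
    exact ih u (by omega)

theorem IsTriangular.iterate_apply {W A : Type*} {σ : W → ℕ} {Φ : (W → A) → W → A}
    (h : IsTriangular σ Φ) (x₀ : W → A) (m : ℕ) (w : W) (hm : σ w + 1 ≤ m) :
    (Φ^[m] x₀) w = triangularFix σ Φ x₀ w := by
  induction m, hm using Nat.le_induction with
  | base => rfl
  | succ m hm ih => rw [h.iterate_succ x₀ m w (by omega), ih]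

theorem IsTriangular.fixed {W A : Type*} {σ : W → ℕ} {Φ : (W → A) → W → A}
    (h : IsTriangular σ Φ) (x₀ : W → A) :
    Φ (triangularFix σ Φ x₀) = triangularFix σ Φ x₀ := by
  funext w
  rw [← h.iterate_apply x₀ (σ w + 1) w le_rfl, Function.iterate_succ_apply']
  exact h _ _ _ fun u hu => (h.iterate_apply x₀ (σ w) u (by omega)).symm

/-- The fixed point is read off from finite iterates, so it inherits any componentwise property
preserved by `Φ`. This yields the homogeneity of the curve and of the logarithm. -/
theorem triangularFix_induction {W A : Type*} {σ : W → ℕ} {Φ : (W → A) → W → A} {x₀ : W → A}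
    (p : W → A → Prop) (h₀ : ∀ w, p w (x₀ w))
    (h : ∀ x, (∀ w, p w (x w)) → ∀ w, p w (Φ x w)) (w : W) : p w (triangularFix σ Φ x₀ w) := by
  have : ∀ m w, p w ((Φ^[m] x₀) w) := by
    intro m
    induction m with
    | zero => exact h₀
    | succ m ih =>
      rw [Function.iterate_succ_apply']
      exact h _ ih
  exact this _ w

/-! ### Functionals on words -/

section Words

variable {R A α : Type*} [CommRing R]

/-- The functional with value `1` on the empty word and `0` on all others. -/
def counit : List A → R
  | [] => 1
  | _ :: _ => 0

/-- The Cauchy product `(c * d)(w) = ∑_{w = uv} c(u) d(v)`. -/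
def cauchy (c d : List A → R) : List A → R
  | [] => c [] * d []
  | a :: w => c [] * d (a :: w) + cauchy (fun v => c (a :: v)) d w

theorem cauchy_add_left (c c' d : List A → R) : cauchy (c + c') d = cauchy c d + cauchy c' d := by
  funext w
  induction w generalizing c c' with
  | nil => simp [cauchy, add_mul]
  | cons a w ih =>
    have := ih (fun v => c (a :: v)) (fun v => c' (a :: v))
    simp only [cauchy, Pi.add_apply] at this ⊢
    rw [show (fun v => c (a :: v) + c' (a :: v)) =
      (fun v => c (a :: v)) + fun v => c' (a :: v) from rfl, this]
    ring

theorem cauchy_add_right (c d d' : List A → R) : cauchy c (d + d') = cauchy c d + cauchy c d' := by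
  funext w
  induction w generalizing c with
  | nil => simp [cauchy, mul_add]
  | cons a w ih =>
    have := ih (fun v => c (a :: v))
    simp only [cauchy, Pi.add_apply] at this ⊢
    rw [this]
    ring

theorem cauchy_smul_left (r : R) (c d : List A → R) : cauchy (r • c) d = r • cauchy c d := by
  funext w
  induction w generalizing c with
  | nil => simp [cauchy, mul_assoc]
  | cons a w ih =>
    have := ih (fun v => c (a :: v))
    simp only [cauchy, Pi.smul_apply, smul_eq_mul] at this ⊢
    rw [show (fun v => r * c (a :: v)) = r • (fun v => c (a :: v)) from rfl, this]
    ring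

theorem cauchy_zero_left (d : List A → R) : cauchy 0 d = 0 := by
  simpa using cauchy_smul_left (0 : R) 0 d

theorem cauchy_sub_left (c c' d : List A → R) : cauchy (c - c') d = cauchy c d - cauchy c' d := by
  rw [sub_eq_add_neg, cauchy_add_left, ← neg_one_smul R c', cauchy_smul_left, neg_one_smul,
    ← sub_eq_add_neg]

theorem cauchy_counit_left (d : List A → R) : cauchy counit d = d := by
  funext w
  cases w with
  | nil => simp [cauchy, counit]
  | cons a w =>
    have := congrFun (cauchy_zero_left d) w
    simp only [cauchy, counit, one_mul]
    rw [show (fun _ : List A => (0 : R)) = 0 from rfl, this]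
    simp

theorem cauchy_counit_right (c : List A → R) : cauchy c counit = c := by
  funext w
  induction w generalizing c with
  | nil => simp [cauchy, counit]
  | cons a w ih => simp [cauchy, counit, ih]

theorem cauchy_cons (c d : List A → R) (a : A) :
    (fun w => cauchy c d (a :: w)) =
      c [] • (fun w => d (a :: w)) + cauchy (fun v => c (a :: v)) d := by
  funext w
  simp [cauchy]

theorem cauchy_assoc (c d e : List A → R) : cauchy (cauchy c d) e = cauchy c (cauchy d e) := by
  funext w
  induction w generalizing c d with
  | nil => simp [cauchy, mul_assoc]
  | cons a w ih =>
    have := ih (fun v => c (a :: v)) d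
    conv_lhs => rw [cauchy, cauchy_cons, cauchy_add_left, cauchy_smul_left]
    simp only [cauchy, Pi.add_apply, Pi.smul_apply, smul_eq_mul, this]
    ring

theorem cauchy_smul_right (c : List A → R) (r : R) (d : List A → R) :
    cauchy c (r • d) = r • cauchy c d := by
  funext w
  induction w generalizing c with
  | nil => simp [cauchy, mul_left_comm]
  | cons a w ih =>
    have := ih (fun v => c (a :: v))
    simp only [cauchy, Pi.smul_apply, smul_eq_mul] at this ⊢
    rw [this]
    ring

theorem cauchy_congr {c c' d d' : List A → R} (w : List A)
    (hc : ∀ u, u.length ≤ w.length → c u = c' u) (hd : ∀ u, u.length ≤ w.length → d u = d' u) :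
    cauchy c d w = cauchy c' d' w := by
  induction w generalizing c c' with
  | nil => simp [cauchy, hc, hd]
  | cons a w ih =>
    simp only [cauchy]
    rw [hc [] (by simp), hd _ le_rfl]
    congr 1
    exact ih (fun u hu => hc _ (by simpa using hu))
      (fun u hu => hd _ (hu.trans (by simp)))

/-! ### Colourings of words, the combinatorial form of the additive coproduct -/

/-- The sum of the values on all coloured versions of a word. -/
def colorSum (h : List (α ⊕ α) → R) : List α → R
  | [] => h []
  | a :: w => colorSum (fun u => h (Sum.inl a :: u)) w + colorSum (fun u => h (Sum.inr a :: u)) w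

theorem colorSum_add (h h' : List (α ⊕ α) → R) : colorSum (h + h') = colorSum h + colorSum h' := by
  funext w
  induction w generalizing h h' with
  | nil => simp [colorSum]
  | cons a w ih =>
    have h1 := ih (fun u => h (Sum.inl a :: u)) (fun u => h' (Sum.inl a :: u))
    have h2 := ih (fun u => h (Sum.inr a :: u)) (fun u => h' (Sum.inr a :: u))
    simp only [Pi.add_apply] at h1 h2
    simp only [colorSum, Pi.add_apply]
    rw [show (fun u => h (Sum.inl a :: u) + h' (Sum.inl a :: u)) =
      (fun u => h (Sum.inl a :: u)) + fun u => h' (Sum.inl a :: u) from rfl, h1,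
      show (fun u => h (Sum.inr a :: u) + h' (Sum.inr a :: u)) =
      (fun u => h (Sum.inr a :: u)) + fun u => h' (Sum.inr a :: u) from rfl, h2]
    ring

theorem colorSum_smul (r : R) (h : List (α ⊕ α) → R) : colorSum (r • h) = r • colorSum h := by
  funext w
  induction w generalizing h with
  | nil => simp [colorSum]
  | cons a w ih =>
    have h1 := ih (fun u => h (Sum.inl a :: u))
    have h2 := ih (fun u => h (Sum.inr a :: u))
    simp only [Pi.smul_apply, smul_eq_mul] at h1 h2
    simp only [colorSum, Pi.smul_apply, smul_eq_mul, mul_add]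
    rw [← h1, ← h2]
    rfl

theorem colorSum_zero : colorSum (0 : List (α ⊕ α) → R) = 0 := by
  simpa using colorSum_smul (0 : R) (0 : List (α ⊕ α) → R)

theorem colorSum_counit : colorSum (counit : List (α ⊕ α) → R) = counit := by
  funext w
  cases w with
  | nil => rfl
  | cons a w =>
    have := congrFun (colorSum_zero (R := R) (α := α)) w
    simp only [colorSum, counit]
    rw [show (fun _ : List (α ⊕ α) => (0 : R)) = 0 from rfl, this]
    simp

theorem colorSum_congr {h h' : List (α ⊕ α) → R} (w : List α)
    (H : ∀ u, u.length = w.length → h u = h' u) : colorSum h w = colorSum h' w := by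
  induction w generalizing h h' with
  | nil => exact H [] rfl
  | cons a w ih =>
    simp only [colorSum]
    rw [ih fun u hu => H (Sum.inl a :: u) (by simpa using hu),
      ih fun u hu => H (Sum.inr a :: u) (by simpa using hu)]

/-- A colouring of a concatenation is a pair of independent colourings of its factors. -/
theorem colorSum_cauchy (c d : List (α ⊕ α) → R) :
    colorSum (cauchy c d) = cauchy (colorSum c) (colorSum d) := by
  funext w
  induction w generalizing c with
  | nil => simp [colorSum, cauchy]
  | cons a w ih =>
    have h1 := ih (fun u => c (Sum.inl a :: u))
    have h2 := ih (fun u => c (Sum.inr a :: u))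
    rw [colorSum, cauchy_cons, cauchy_cons, colorSum_add, colorSum_add, colorSum_smul,
      colorSum_smul, cauchy]
    simp only [Pi.add_apply, Pi.smul_apply, smul_eq_mul, h1, h2, colorSum]
    rw [show (fun v => colorSum (fun u => c (Sum.inl a :: u)) v +
      colorSum (fun u => c (Sum.inr a :: u)) v) = colorSum (fun u => c (Sum.inl a :: u)) +
      colorSum (fun u => c (Sum.inr a :: u)) from rfl, cauchy_add_left]
    simp only [Pi.add_apply]
    ring

/-- Extension by zero to the words with a letter `y_i`. -/
def extendLeft (c : List α → R) : List (α ⊕ α) → R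
  | [] => c []
  | Sum.inl a :: u => extendLeft (fun v => c (a :: v)) u
  | Sum.inr _ :: _ => 0

/-- Extension by zero to the words with a letter `x_i`. -/
def extendRight (c : List α → R) : List (α ⊕ α) → R
  | [] => c []
  | Sum.inl _ :: _ => 0
  | Sum.inr a :: u => extendRight (fun v => c (a :: v)) u

theorem colorSum_extendLeft (c : List α → R) : colorSum (extendLeft c) = c := by
  funext w
  induction w generalizing c with
  | nil => rfl
  | cons a w ih =>
    have h := congrFun (colorSum_zero (R := R) (α := α)) w
    simp only [colorSum, extendLeft, ih]
    rw [show (fun _ : List (α ⊕ α) => (0 : R)) = 0 from rfl, h]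
    simp

theorem colorSum_extendRight (c : List α → R) : colorSum (extendRight c) = c := by
  funext w
  induction w generalizing c with
  | nil => rfl
  | cons a w ih =>
    have h := congrFun (colorSum_zero (R := R) (α := α)) w
    simp only [colorSum, extendRight, ih]
    rw [show (fun _ : List (α ⊕ α) => (0 : R)) = 0 from rfl, h]
    simp

theorem extendLeft_map_inl (c : List α → R) (w : List α) :
    extendLeft c (w.map Sum.inl) = c w := by
  induction w generalizing c with
  | nil => rfl
  | cons a w ih => simp [extendLeft, ih]

theorem extendRight_map_inr (c : List α → R) (w : List α) :
    extendRight c (w.map Sum.inr) = c w := by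
  induction w generalizing c with
  | nil => rfl
  | cons a w ih => simp [extendRight, ih]

theorem extendLeft_eq_zero (c : List α → R) (u : List (α ⊕ α)) (hu : ∃ a, Sum.inr a ∈ u) :
    extendLeft c u = 0 := by
  induction u generalizing c with
  | nil => simp at hu
  | cons b u ih =>
    rcases b with b | b
    · exact ih _ (by simpa using hu)
    · rfl

theorem extendRight_eq_zero (c : List α → R) (u : List (α ⊕ α)) (hu : ∃ a, Sum.inl a ∈ u) :
    extendRight c u = 0 := by
  induction u generalizing c with
  | nil => simp at hu
  | cons b u ih =>
    rcases b with b | b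
    · rfl
    · exact ih _ (by simpa using hu)

theorem cauchy_map {B : Type*} (φ : A → B) (c d : List B → R) (w : List A) :
    cauchy c d (w.map φ) = cauchy (fun v => c (v.map φ)) (fun v => d (v.map φ)) w := by
  induction w generalizing c with
  | nil => rfl
  | cons a w ih => simp [cauchy, ih]

/-! ### Moments and cumulants -/

/-- The transfer operator of a letter: the letter `a` either closes a position of a block that is
already open or opens a new block, with the weights `κ a`. The bilinear operation `β` says where
new blocks may be opened. -/
def transfer (β : (List A → R) → (List A → R) → List A → R) (κ : A → List A → R) (c : List A → R)
    (a : A) : List A → R :=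
  (fun w => c (a :: w)) + β (κ a) c

/-- The value of the word `u` on the state `c`. -/
def runWord (β : (List A → R) → (List A → R) → List A → R) (κ : A → List A → R)
    (c : List A → R) (u : List A) : R :=
  u.foldl (transfer β κ) c []

/-- The moments of the functional with cumulants `κ`, where `κ a w` is the cumulant of `aw`. -/
def moments (β : (List A → R) → (List A → R) → List A → R) (κ : A → List A → R) : List A → R :=
  runWord β κ counit

/-- The Cauchy product restricted to the trivial factorizations: new blocks may be opened only
when no block is open. -/
def outer (k c : List A → R) : List A → R := c [] • k

theorem transfer_apply (β : (List A → R) → (List A → R) → List A → R) (κ : A → List A → R)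
    (c : List A → R) (a : A) (w : List A) : transfer β κ c a w = c (a :: w) + β (κ a) c w := rfl

theorem runWord_nil (β : (List A → R) → (List A → R) → List A → R) (κ : A → List A → R)
    (c : List A → R) : runWord β κ c [] = c [] := rfl

theorem runWord_cons (β : (List A → R) → (List A → R) → List A → R) (κ : A → List A → R)
    (c : List A → R) (a : A) (u : List A) :
    runWord β κ c (a :: u) = runWord β κ (transfer β κ c a) u := rfl

theorem runWord_append (β : (List A → R) → (List A → R) → List A → R) (κ : A → List A → R)
    (c : List A → R) (v u : List A) :
    runWord β κ c (v ++ u) = runWord β κ (v.foldl (transfer β κ) c) u := by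
  simp [runWord]

theorem transfer_counit {β : (List A → R) → (List A → R) → List A → R}
    (hβ : ∀ k, β k counit = k) (κ : A → List A → R) (a : A) : transfer β κ counit a = κ a := by
  funext w
  simp [transfer, hβ, counit]

/-- The run on `u` has leading term `c u`, in which no new block is opened. Every opening consumes a
letter, so the rest involves only shorter words; this makes the equations for cumulants triangular.
-/
theorem runWord_sub_congr {β : (List A → R) → (List A → R) → List A → R}
    (hβ : ∀ (k k' c c' : List A → R) w, (∀ u, u.length ≤ w.length → k u = k' u) →
      (∀ u, u.length ≤ w.length → c u = c' u) → β k c w = β k' c' w)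
    {κ κ' : A → List A → R} {c c' : List A → R} (u : List A)
    (hκ : ∀ a v, v.length < u.length → κ a v = κ' a v)
    (hc : ∀ v, v.length < u.length → c v = c' v) :
    runWord β κ c u - c u = runWord β κ' c' u - c' u := by
  induction u generalizing c c' with
  | nil => simp [runWord]
  | cons b q ih =>
    have h1 : ∀ w : List A, w.length ≤ q.length → β (κ b) c w = β (κ' b) c' w := fun w hw =>
      hβ _ _ _ _ _ (fun v hv => hκ _ _ (by simp; omega)) (fun v hv => hc _ (by simp; omega))
    have := ih (c := transfer β κ c b) (c' := transfer β κ' c' b)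
      (fun a v hv => hκ a v (by simp; omega)) (fun v hv => by
        simp only [transfer, Pi.add_apply]
        rw [h1 v hv.le, hc (b :: v) (by simpa using hv)])
    rw [transfer_apply, transfer_apply, h1 q le_rfl] at this
    rw [runWord_cons, runWord_cons]
    linear_combination this

/-- The equation for the moment at `au` contains the cumulant `κ a u` with coefficient one and
otherwise only cumulants of shorter words, so it can be solved recursively. -/
theorem exists_moments_eq {β : (List A → R) → (List A → R) → List A → R}
    (hβ : ∀ (k k' c c' : List A → R) w, (∀ u, u.length ≤ w.length → k u = k' u) →
      (∀ u, u.length ≤ w.length → c u = c' u) → β k c w = β k' c' w)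
    (hβ' : ∀ k, β k counit = k) (f : List A → R) (hf : f [] = 1) :
    ∃ κ, moments β κ = f := by
  -- The pair `(a, u)` stands for the word `au`, with degree the length of `u`; a fixed point is
  -- exactly a solution of the moment equations.
  let Φ : (A × List A → R) → A × List A → R := fun κ p =>
    f (p.1 :: p.2) -
      (runWord β (Function.curry κ) (Function.curry κ p.1) p.2 - Function.curry κ p.1 p.2)
  have hΦ : IsTriangular (fun p : A × List A => p.2.length) Φ := fun κ κ' p h => by
    simp only [Φ]
    congr 1
    exact runWord_sub_congr hβ _ (fun a v hv => h (a, v) hv) (fun v hv => h (_, v) hv)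
  have hfix := hΦ.fixed 0
  generalize triangularFix (fun p : A × List A => p.2.length) Φ 0 = κ at hfix
  refine ⟨Function.curry κ, ?_⟩
  funext w
  cases w with
  | nil => simp [moments, runWord, counit, hf]
  | cons a u =>
    have : f (a :: u) - (runWord β (Function.curry κ) (Function.curry κ a) u -
      Function.curry κ a u) = Function.curry κ a u := congrFun hfix (a, u)
    rw [moments, runWord_cons, transfer_counit hβ']
    linear_combination -this

theorem runWord_add {β : (List A → R) → (List A → R) → List A → R}
    (hβ : ∀ k c c', β k (c + c') = β k c + β k c') (κ : A → List A → R) (c c' : List A → R)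
    (u : List A) : runWord β κ (c + c') u = runWord β κ c u + runWord β κ c' u := by
  induction u generalizing c c' with
  | nil => rfl
  | cons a u ih =>
    rw [runWord_cons, runWord_cons, runWord_cons, ← ih]
    congr 1
    funext w
    simp only [transfer, hβ, Pi.add_apply]
    ring

theorem runWord_smul {β : (List A → R) → (List A → R) → List A → R}
    (hβ : ∀ k (r : R) c, β k (r • c) = r • β k c) (κ : A → List A → R) (r : R) (c : List A → R)
    (u : List A) : runWord β κ (r • c) u = r * runWord β κ c u := by
  induction u generalizing c with
  | nil => rfl
  | cons a u ih =>
    rw [runWord_cons, runWord_cons, ← ih]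
    congr 1
    funext w
    simp only [transfer, hβ, Pi.add_apply, Pi.smul_apply, smul_eq_mul]
    ring

theorem moments_zero {β : (List A → R) → (List A → R) → List A → R}
    (hβ : ∀ c, β 0 c = 0) : moments β (0 : A → List A → R) = counit := by
  have : ∀ c u, runWord β (0 : A → List A → R) c u = c u := by
    intro c u
    induction u generalizing c with
    | nil => rfl
    | cons a u ih =>
      rw [runWord_cons, ih]
      simp [transfer, hβ]
  exact funext (this counit)

/-- Linearity in the state merges the two branches for the colour of the next letter into a single
state, in which the cumulants of the two colours are added. -/
theorem colorSum_runWord {β : (List (α ⊕ α) → R) → (List (α ⊕ α) → R) → List (α ⊕ α) → R}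
    {γ : (List α → R) → (List α → R) → List α → R}
    (hβγ : ∀ k c, colorSum (β k c) = γ (colorSum k) (colorSum c))
    (hγ : ∀ k c c', γ k (c + c') = γ k c + γ k c') (hγ' : ∀ k k' c, γ (k + k') c = γ k c + γ k' c)
    (κ : α ⊕ α → List (α ⊕ α) → R) (c : List (α ⊕ α) → R) (w : List α) :
    colorSum (runWord β κ c) w =
      runWord γ (fun a => colorSum (κ (Sum.inl a)) + colorSum (κ (Sum.inr a))) (colorSum c) w := by
  induction w generalizing c with
  | nil => rfl
  | cons a w ih =>
    have h1 := ih (transfer β κ c (Sum.inl a))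
    have h2 := ih (transfer β κ c (Sum.inr a))
    simp only [colorSum, runWord_cons]
    rw [h1, h2, ← runWord_add hγ]
    congr 1
    simp only [transfer, colorSum_add, hβγ, hγ']
    funext v
    simp only [Pi.add_apply, colorSum]
    ring

/-- The cumulants of a product of independent functionals: mixed cumulants vanish. -/
def mixedCumulants (κ κ' : α → List α → R) : α ⊕ α → List (α ⊕ α) → R
  | Sum.inl a => extendLeft (κ a)
  | Sum.inr a => extendRight (κ' a)

theorem colorSum_moments {β : (List (α ⊕ α) → R) → (List (α ⊕ α) → R) → List (α ⊕ α) → R}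
    {γ : (List α → R) → (List α → R) → List α → R}
    (hβγ : ∀ k c, colorSum (β k c) = γ (colorSum k) (colorSum c))
    (hγ : ∀ k c c', γ k (c + c') = γ k c + γ k c') (hγ' : ∀ k k' c, γ (k + k') c = γ k c + γ k' c)
    (κ κ' : α → List α → R) :
    colorSum (moments β (mixedCumulants κ κ')) = moments γ (κ + κ') := by
  funext w
  rw [moments, colorSum_runWord hβγ hγ hγ', colorSum_counit]
  simp only [mixedCumulants, colorSum_extendLeft, colorSum_extendRight]
  rfl

theorem runWord_map {B : Type*} {β : (List B → R) → (List B → R) → List B → R}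
    {γ : (List A → R) → (List A → R) → List A → R} (φ : A → B)
    (hβγ : ∀ k c w, β k c (w.map φ) = γ (fun v => k (v.map φ)) (fun v => c (v.map φ)) w)
    (κ : B → List B → R) (c : List B → R) (w : List A) :
    runWord β κ c (w.map φ) =
      runWord γ (fun a v => κ (φ a) (v.map φ)) (fun v => c (v.map φ)) w := by
  induction w generalizing c with
  | nil => rfl
  | cons a w ih =>
    rw [List.map_cons, runWord_cons, runWord_cons, ih]
    congr 1
    funext v
    simp [transfer, hβγ]

theorem counit_map {B : Type*} (φ : A → B) :
    (fun v : List A => (counit (v.map φ) : R)) = counit := by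
  funext v
  cases v <;> rfl

theorem moments_mixed_inl {β : (List (α ⊕ α) → R) → (List (α ⊕ α) → R) → List (α ⊕ α) → R}
    {γ : (List α → R) → (List α → R) → List α → R}
    (hβγ : ∀ k c w, β k c (w.map Sum.inl) =
      γ (fun v => k (v.map Sum.inl)) (fun v => c (v.map Sum.inl)) w)
    (κ κ' : α → List α → R) (w : List α) :
    moments β (mixedCumulants κ κ') (w.map Sum.inl) = moments γ κ w := by
  rw [moments, runWord_map Sum.inl hβγ, counit_map]
  simp only [mixedCumulants, extendLeft_map_inl]
  rfl

theorem moments_mixed_inr {β : (List (α ⊕ α) → R) → (List (α ⊕ α) → R) → List (α ⊕ α) → R}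
    {γ : (List α → R) → (List α → R) → List α → R}
    (hβγ : ∀ k c w, β k c (w.map Sum.inr) =
      γ (fun v => k (v.map Sum.inr)) (fun v => c (v.map Sum.inr)) w)
    (κ κ' : α → List α → R) (w : List α) :
    moments β (mixedCumulants κ κ') (w.map Sum.inr) = moments γ κ' w := by
  rw [moments, runWord_map Sum.inr hβγ, counit_map]
  simp only [mixedCumulants, extendRight_map_inr]
  rfl

end Words

/-! ### Alternating decompositions -/

section Blocks

variable {R α : Type*} [CommRing R]

/-- The words of the list are nonempty, consist of letters of one kind, the kinds alternate, and
the first one consists of letters `x_i` if `b` is true and of letters `y_i` otherwise. -/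
def Alternating : Bool → List (List (α ⊕ α)) → Prop
  | _, [] => True
  | b, v :: L => v ≠ [] ∧ (∀ a ∈ v, a.isLeft = b) ∧ Alternating (!b) L

theorem isLeft_eq_of_isChain {a : α ⊕ α} {v : List (α ⊕ α)}
    (h : (a :: v).IsChain fun x y => x.isLeft == y.isLeft) :
    ∀ x ∈ a :: v, x.isLeft = a.isLeft := by
  induction v generalizing a with
  | nil => simp
  | cons c v ih =>
    rw [List.isChain_cons_cons] at h
    intro x hx
    rcases List.mem_cons.1 hx with rfl | hx
    · rfl
    · rw [ih h.2 x hx]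
      exact (beq_iff_eq.1 h.1).symm

/-- Kinds are constant inside each block, so the condition on the last and first letters of adjacent
blocks forces the kind to flip. The hypothesis on the head of `L` fixes the initial kind. -/
theorem alternating_of_isChain (L : List (List (α ⊕ α))) (hn : [] ∉ L)
    (hc : ∀ m ∈ L, m.IsChain fun x y => x.isLeft == y.isLeft)
    (hL : L.IsChain fun a b => ∃ ha hb, ((a.getLast ha).isLeft == (b.head hb).isLeft) = false)
    (b : Bool) (hb : ∀ v ∈ L.head?, ∀ x ∈ v.head?, x.isLeft = b) : Alternating b L := by
  induction L generalizing b with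
  | nil => trivial
  | cons v L ih =>
    obtain _ | ⟨a, v⟩ := v
    · simp at hn
    have hab : a.isLeft = b := hb (a :: v) rfl a rfl
    have hv := isLeft_eq_of_isChain (hc _ List.mem_cons_self)
    refine ⟨by simp, fun x hx => (hv x hx).trans hab,
      ih (fun h => hn (List.mem_cons_of_mem _ h)) (fun m hm => hc m (List.mem_cons_of_mem _ hm))
        hL.tail _ ?_⟩
    intro w hw x hx
    obtain _ | ⟨w', L⟩ := L
    · simp at hw
    obtain rfl : w' = w := by simpa using hw
    obtain ⟨_, hw'⟩ := (List.isChain_cons_cons.1 hL).1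
    obtain ⟨hne, h⟩ := hw'
    obtain _ | ⟨y, w⟩ := w'
    · simp at hne
    obtain rfl : y = x := by simpa using hx
    rw [hv _ (List.getLast_mem _), hab] at h
    rw [List.head_cons] at h
    generalize y.isLeft = q at h ⊢
    cases b <;> cases q <;> simp_all

theorem exists_alternating_blocks (u : List (α ⊕ α)) : ∃ b, Alternating b (blocks u) := by
  have h := alternating_of_isChain (blocks u) (List.nil_notMem_splitBy _ _)
    (fun m hm => List.isChain_of_mem_splitBy hm)
    (List.isChain_getLast_head_splitBy (fun a b => a.isLeft == b.isLeft) u)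
  rcases hu : blocks u with _ | ⟨v, L⟩
  · exact ⟨true, trivial⟩
  rw [hu] at h
  obtain _ | ⟨a, v⟩ := v
  · have : [] ∈ blocks u := by rw [hu]; simp
    exact absurd this (List.nil_notMem_splitBy _ _)
  · exact ⟨a.isLeft, h _ (by rintro _ ⟨⟩ _ ⟨⟩; rfl)⟩

theorem blocks_flatten (u : List (α ⊕ α)) : (blocks u).flatten = u := List.flatten_splitBy _ u

theorem map_inl_xPart (v : List (α ⊕ α)) (hv : ∀ a ∈ v, a.isLeft = true) :
    (xPart v).map Sum.inl = v := by
  induction v with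
  | nil => rfl
  | cons a v ih =>
    obtain a | a := a
    · simpa [xPart] using ih fun b hb => hv b (List.mem_cons_of_mem _ hb)
    · simp at hv

theorem map_inr_yPart (v : List (α ⊕ α)) (hv : ∀ a ∈ v, a.isLeft = false) :
    (yPart v).map Sum.inr = v := by
  induction v with
  | nil => rfl
  | cons a v ih =>
    obtain a | a := a
    · simp at hv
    · simpa [yPart] using ih fun b hb => hv b (List.mem_cons_of_mem _ hb)

theorem blockValue_eq {f g : List α → R} {ψ : List (α ⊕ α) → R}
    (hf : ∀ w, ψ (w.map Sum.inl) = f w) (hg : ∀ w, ψ (w.map Sum.inr) = g w)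
    {b : Bool} {v : List (α ⊕ α)} (hn : v ≠ []) (hv : ∀ a ∈ v, a.isLeft = b) :
    blockValue f g v = ψ v := by
  obtain _ | ⟨a | a, v⟩ := v
  · exact absurd rfl hn
  · obtain rfl : true = b := by simpa using hv (Sum.inl a) List.mem_cons_self
    rw [blockValue, ← hf, map_inl_xPart _ hv]
  · obtain rfl : false = b := by simpa using hv (Sum.inr a) List.mem_cons_self
    rw [blockValue, ← hg, map_inr_yPart _ hv]

/-- The functional vanishes on the words with a letter of the kind other than `b`. -/
def SupportedOn (b : Bool) (c : List (α ⊕ α) → R) : Prop :=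
  ∀ w, (∃ a ∈ w, a.isLeft = !b) → c w = 0

/-- The functional vanishes on the words that begin with a letter of kind `b`. -/
def Avoids (b : Bool) (c : List (α ⊕ α) → R) : Prop :=
  ∀ a w, a.isLeft = b → c (a :: w) = 0

theorem supportedOn_mixedCumulants (κ κ' : α → List α → R) (a : α ⊕ α) :
    SupportedOn a.isLeft (mixedCumulants κ κ' a) := by
  rintro w ⟨x, hx, h⟩
  obtain a | a := a
  · obtain x | x := x
    · simp at h
    · exact extendLeft_eq_zero _ _ ⟨x, hx⟩
  · obtain x | x := x
    · exact extendRight_eq_zero _ _ ⟨x, hx⟩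
    · simp at h

theorem SupportedOn.der {b : Bool} {c : List (α ⊕ α) → R} (h : SupportedOn b c) (a : α ⊕ α) :
    SupportedOn b fun w => c (a :: w) := by
  rintro w ⟨x, hx, hb⟩
  exact h _ ⟨x, List.mem_cons_of_mem _ hx, hb⟩

theorem supportedOn_counit (b : Bool) : SupportedOn b (counit : List (α ⊕ α) → R) := by
  rintro w ⟨x, hx, -⟩
  obtain _ | ⟨y, w⟩ := w
  · simp at hx
  · rfl

theorem SupportedOn.add {b : Bool} {c d : List (α ⊕ α) → R} (hc : SupportedOn b c)
    (hd : SupportedOn b d) : SupportedOn b (c + d) := fun w hw => by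
  simp [hc w hw, hd w hw]

theorem SupportedOn.smul {b : Bool} {d : List (α ⊕ α) → R} (r : R)
    (hd : SupportedOn b d) : SupportedOn b (r • d) := fun _ hw => by
  simp [hd _ hw]

theorem SupportedOn.avoids {b : Bool} {c : List (α ⊕ α) → R} (hc : SupportedOn b c) :
    Avoids (!b) c := fun a _ ha => hc _ ⟨a, List.mem_cons_self, ha⟩

theorem SupportedOn.cauchy {b : Bool} {c d : List (α ⊕ α) → R} (hc : SupportedOn b c)
    (hd : SupportedOn b d) : SupportedOn b (cauchy c d) := by
  intro w hw
  induction w generalizing c with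
  | nil => simp at hw
  | cons a w ih =>
    rw [MomentConvolution.cauchy, hd _ hw, mul_zero, zero_add]
    by_cases h : a.isLeft = !b
    · rw [show (fun v => c (a :: v)) = 0 from funext fun v => hc _ ⟨a, List.mem_cons_self, h⟩,
        cauchy_zero_left]
      rfl
    · refine ih (hc.der a) ?_
      obtain ⟨x, hx, hb⟩ := hw
      rcases List.mem_cons.1 hx with rfl | hx
      · exact absurd hb h
      · exact ⟨x, hx, hb⟩

theorem supportedOn_foldl {β : (List (α ⊕ α) → R) → (List (α ⊕ α) → R) → List (α ⊕ α) → R}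
    {b : Bool} (hβ : ∀ k c, SupportedOn b k → SupportedOn b c → SupportedOn b (β k c))
    (κ κ' : α → List α → R) {c : List (α ⊕ α) → R} (hc : SupportedOn b c) (v : List (α ⊕ α))
    (hv : ∀ a ∈ v, a.isLeft = b) :
    SupportedOn b (v.foldl (transfer β (mixedCumulants κ κ')) c) := by
  induction v generalizing c with
  | nil => exact hc
  | cons a v ih =>
    refine ih ((hc.der a).add (hβ _ _ ?_ hc)) fun x hx => hv x (List.mem_cons_of_mem _ hx)
    have := supportedOn_mixedCumulants κ κ' a
    rwa [hv a List.mem_cons_self] at this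

/-! ### The boolean product -/

/-- The first letter cannot continue an open block, so it can only open a new one. The resulting
state is `c []` times the one obtained from `counit`, and the scalar factors out. -/
theorem runWord_outer_of_avoids (κ κ' : α → List α → R) {b : Bool} {c : List (α ⊕ α) → R}
    (hc : Avoids b c) {L : List (List (α ⊕ α))} (hL : Alternating b L) :
    runWord outer (mixedCumulants κ κ') c L.flatten =
      c [] * moments outer (mixedCumulants κ κ') L.flatten := by
  obtain _ | ⟨v, L⟩ := L
  · simp [runWord, moments, counit]
  obtain _ | ⟨a, v⟩ := v
  · exact absurd rfl hL.1
  rw [moments, List.flatten_cons, List.cons_append, runWord_cons, runWord_cons,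
    ← runWord_smul (fun k r c => by simp [outer, smul_smul])]
  congr 1
  funext w
  simp [transfer, outer, counit, hc a w (hL.2.1 a List.mem_cons_self)]

/-- After one block is read, the state is supported on its kind, so the next block starts afresh and
the value splits off as a factor. -/
theorem moments_outer_flatten (κ κ' : α → List α → R) {b : Bool} {L : List (List (α ⊕ α))}
    (hL : Alternating b L) :
    moments outer (mixedCumulants κ κ') L.flatten =
      (L.map (moments outer (mixedCumulants κ κ'))).prod := by
  induction L generalizing b with
  | nil => simp [moments, runWord, counit]
  | cons v L ih =>
    rw [List.flatten_cons, moments, runWord_append, runWord_outer_of_avoids κ κ'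
      (supportedOn_foldl (β := outer) (fun k c hk _ => hk.smul (c [])) κ κ' (supportedOn_counit b) v hL.2.1).avoids
      hL.2.2, ih hL.2.2, List.map_cons, List.prod_cons]
    rfl

theorem outer_map {A B : Type*} (φ : A → B) (k c : List B → R) (w : List A) :
    outer k c (w.map φ) = outer (fun v => k (v.map φ)) (fun v => c (v.map φ)) w := rfl

theorem booleanValue_moments (κ κ' : α → List α → R) :
    booleanValue (moments outer κ) (moments outer κ') =
      moments outer (mixedCumulants κ κ') := by
  funext u
  obtain ⟨b, hb⟩ := exists_alternating_blocks u
  conv_rhs => rw [← blocks_flatten u, moments_outer_flatten κ κ' hb]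
  unfold booleanValue
  generalize blocks u = L at hb
  induction L generalizing b with
  | nil => rfl
  | cons v L ih =>
    rw [List.map_cons, List.prod_cons, List.map_cons, List.prod_cons, ih _ hb.2.2,
      blockValue_eq (moments_mixed_inl (outer_map _) κ κ')
        (moments_mixed_inr (outer_map _) κ κ') hb.1 hb.2.1]

/-! ### The free product -/

/-- The right factor does not respond to letters of kind `b`, and by associativity newly opened
blocks attach to the left factor. So the whole reading takes place in the left factor. -/
theorem foldl_transfer_cauchy {b : Bool} (κ : α ⊕ α → List (α ⊕ α) → R)
    {c : List (α ⊕ α) → R} (hc : Avoids b c) (e : List (α ⊕ α) → R) (v : List (α ⊕ α))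
    (hv : ∀ a ∈ v, a.isLeft = b) :
    v.foldl (transfer cauchy κ) (cauchy e c) = cauchy (v.foldl (transfer cauchy κ) e) c := by
  induction v generalizing e with
  | nil => rfl
  | cons a v ih =>
    rw [List.foldl_cons, List.foldl_cons, ← ih _ fun x hx => hv x (List.mem_cons_of_mem _ hx)]
    congr 1
    rw [transfer, transfer, cauchy_add_left, cauchy_cons, cauchy_assoc,
      show (fun w => c (a :: w)) = 0 from funext fun w => hc a w (hv a List.mem_cons_self)]
    simp

/-- The concatenation of the words with positions in `I`. -/
def concatOn {A : Type*} (L : List (List A)) (I : Finset (Fin L.length)) : List A :=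
  ((List.finRange L.length).filter (fun i => i ∈ I)).flatMap (fun i => L.get i)

/-- The value of `h` on the product of the differences `v - φ(v)`, for `v` in `L`. -/
def centeredValue {A : Type*} (h φ : List A → R) (L : List (List A)) : R :=
  ∑ I : Finset (Fin L.length), (-1) ^ Iᶜ.card * h (concatOn L I) * ∏ i ∈ Iᶜ, φ (L.get i)

theorem sum_finset_fin_succ (m : ℕ) (G : Finset (Fin (m + 1)) → R) :
    ∑ I, G I = ∑ J : Finset (Fin m), (G (J.map (Fin.succEmb m)) +
      G (insert 0 (J.map (Fin.succEmb m)))) := by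
  classical
  have h0 : (0 : Fin (m + 1)) ∉ Finset.univ.map (Fin.succEmb m) := by simp
  have hu : (Finset.univ : Finset (Fin (m + 1))) = insert 0 (Finset.univ.map (Fin.succEmb m)) := by
    ext i
    refine Fin.cases ?_ (fun j => ?_) i <;> simp
  have hp : (Finset.univ.map (Fin.succEmb m)).powerset =
      Finset.univ.map (Finset.mapEmbedding (Fin.succEmb m)).toEmbedding := by
    ext I
    simp only [Finset.mem_powerset, Finset.mem_map, Finset.mem_univ, true_and,
      Finset.subset_map_iff]
    constructor
    · rintro ⟨J, -, rfl⟩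
      exact ⟨J, rfl⟩
    · rintro ⟨J, rfl⟩
      exact ⟨J, Finset.subset_univ _, rfl⟩
  rw [← Finset.powerset_univ, hu, Finset.sum_powerset_insert h0, hp, Finset.sum_map,
    Finset.sum_map, ← Finset.sum_add_distrib]
  rfl

theorem concatOn_cons_map {A : Type*} (v : List A) (L : List (List A))
    (J : Finset (Fin L.length)) :
    concatOn (v :: L) (J.map (Fin.succEmb L.length)) = concatOn L J := by
  simp only [concatOn, List.length_cons, List.finRange_succ, List.filter_cons, List.filter_map]
  simp [List.flatMap_map, Function.comp_def]

theorem concatOn_cons_insert {A : Type*} (v : List A) (L : List (List A))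
    (J : Finset (Fin L.length)) :
    concatOn (v :: L) (insert 0 (J.map (Fin.succEmb L.length))) = v ++ concatOn L J := by
  simp only [concatOn, List.length_cons, List.finRange_succ, List.filter_cons, List.filter_map]
  simp [List.flatMap_map, Function.comp_def, Fin.succ_ne_zero]

/-- Separating the subsets by membership of the first position expands the first factor `v - φ v`
and absorbs it into the functional. -/
theorem centeredValue_cons {A : Type*} (h φ : List A → R) (v : List A) (L : List (List A)) :
    centeredValue h φ (v :: L) =
      centeredValue (fun u => h (v ++ u) - φ v * h u) φ L := by
  classical
  have c1 : ∀ J : Finset (Fin L.length), (J.map (Fin.succEmb L.length))ᶜ =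
      insert 0 (Jᶜ.map (Fin.succEmb L.length)) := fun J => by
    ext i
    refine Fin.cases ?_ (fun j => ?_) i <;> simp
  have c2 : ∀ J : Finset (Fin L.length), (insert 0 (J.map (Fin.succEmb L.length)))ᶜ =
      Jᶜ.map (Fin.succEmb L.length) := fun J => by
    ext i
    refine Fin.cases ?_ (fun j => ?_) i <;> simp
  unfold centeredValue
  refine (sum_finset_fin_succ L.length _).trans (Finset.sum_congr rfl fun J _ => ?_)
  have h0 : (0 : Fin (L.length + 1)) ∉ Jᶜ.map (Fin.succEmb L.length) := by simp
  have e1 := concatOn_cons_map v L J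
  have e2 := concatOn_cons_insert v L J
  simp only [List.length_cons] at e1 e2 ⊢
  rw [e1, e2, c1, c2, Finset.prod_insert h0, Finset.card_insert_of_notMem h0, Finset.prod_map,
    Finset.card_map]
  simp only [List.get_eq_getElem, Fin.coe_succEmb, Fin.val_succ, List.getElem_cons_succ,
    Fin.val_zero, List.getElem_cons_zero]
  ring

/-- Freeness in the form "alternating products of centred elements have value zero". Reading a
centred block puts a factor without constant term in front of the state. The new state vanishes on
the empty word and avoids the other kind, so the next block can only add another such factor and
never close this one. -/
theorem centeredValue_eq_zero (κ κ' : α → List α → R) {L : List (List (α ⊕ α))} {b : Bool}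
    (hL : Alternating b L) {c : List (α ⊕ α) → R} (hc : Avoids b c) (h : L ≠ [] ∨ c [] = 0) :
    centeredValue (runWord cauchy (mixedCumulants κ κ') c)
      (moments cauchy (mixedCumulants κ κ')) L = 0 := by
  induction L generalizing b c with
  | nil =>
    have h0 : c [] = 0 := by simpa using h
    refine Finset.sum_eq_zero fun I _ => ?_
    have : concatOn ([] : List (List (α ⊕ α))) I = [] := rfl
    rw [this, runWord_nil, h0]
    simp
  | cons v L ih =>
    set ψ := moments cauchy (mixedCumulants κ κ') with hψ
    set e := v.foldl (transfer cauchy (mixedCumulants κ κ')) counit with he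
    -- The state after reading the centred block `v - ψ v` from `counit`: it is supported on kind
    -- `b` and its constant term cancels.
    set d := e - ψ v • counit with hd
    have hsupp : SupportedOn b d := by
      rw [hd, sub_eq_add_neg, ← neg_smul]
      exact (supportedOn_foldl (fun _ _ => SupportedOn.cauchy) κ κ' (supportedOn_counit b) v
        hL.2.1).add ((supportedOn_counit b).smul _)
    have hd0 : d [] = 0 := by
      simp [hd, hψ, he, moments, runWord, counit]
    have hrun : (fun u => runWord cauchy (mixedCumulants κ κ') c (v ++ u) -
        ψ v * runWord cauchy (mixedCumulants κ κ') c u) =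
        runWord cauchy (mixedCumulants κ κ') (cauchy d c) := by
      funext u
      have hadd := runWord_add (cauchy_add_right (R := R)) (mixedCumulants κ κ')
        (cauchy d c) (ψ v • c) u
      rw [runWord_smul cauchy_smul_right, show cauchy d c + ψ v • c = cauchy e c from ?_,
        he, ← foldl_transfer_cauchy _ hc _ _ hL.2.1, cauchy_counit_left, ← runWord_append] at hadd
      · linear_combination hadd
      · rw [hd, cauchy_sub_left, cauchy_smul_left, cauchy_counit_left]
        abel
    rw [centeredValue_cons, hrun]
    refine ih hL.2.2 (fun a w ha => ?_) (Or.inr ?_)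
    · have hz : (fun v => d (a :: v)) = 0 := funext fun v => hsupp.avoids a v ha
      rw [cauchy, hd0, hz, cauchy_zero_left]
      simp
    · simp [cauchy, hd0]

/-- The recursion defining the free product is the vanishing of centred alternating products, solved
for the term with all blocks. Both sides thus satisfy the same recursion on length. -/
theorem freeValue_moments (κ κ' : α → List α → R) :
    freeValue (moments cauchy κ) (moments cauchy κ') =
      moments cauchy (mixedCumulants κ κ') := by
  classical
  set ψ := moments cauchy (mixedCumulants κ κ') with hψ
  have key : ∀ m (u : List (α ⊕ α)), u.length = m →
      freeValue (moments cauchy κ) (moments cauchy κ') u = ψ u := by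
    intro m
    induction m using Nat.strong_induction_on with
    | _ m ih =>
      intro u hu
      by_cases hn : u = []
      · subst hn
        rw [freeValue]
        simp [hψ, moments, runWord, counit]
      obtain ⟨b, hb⟩ := exists_alternating_blocks u
      have hz := centeredValue_eq_zero κ κ' hb (c := counit) (fun _ _ _ => rfl)
        (Or.inl (by simpa [blocks] using hn))
      have hblock : ∀ v ∈ blocks u, blockValue (moments cauchy κ) (moments cauchy κ') v = ψ v := by
        generalize blocks u = L at hb
        induction L generalizing b with
        | nil => simp
        | cons v L ihL =>
          intro w hw
          rcases List.mem_cons.1 hw with rfl | hw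
          · exact blockValue_eq (moments_mixed_inl (cauchy_map _) κ κ')
              (moments_mixed_inr (cauchy_map _) κ κ') hb.1 hb.2.1
          · exact ihL _ hb.2.2 w hw
      rw [freeValue, if_neg hn]
      -- The full index set contributes `ψ u` itself. Moving the other terms across changes their
      -- sign, which accounts for the `+ 1` in the exponent of the recursion.
      rw [centeredValue, ← Finset.add_sum_erase _ _ (Finset.mem_univ Finset.univ)] at hz
      have hcu : concatOn (blocks u) Finset.univ = u := by
        conv_rhs => rw [← blocks_flatten u]
        simp only [concatOn, Finset.mem_univ, decide_true, List.filter_true]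
        rw [List.flatMap_def, List.map_get_finRange]
      rw [hcu, Finset.compl_univ, Finset.card_empty, Finset.prod_empty, pow_zero, one_mul, mul_one,
        Finset.sum_subtype _ (p := fun I => I ≠ Finset.univ) (fun I => by simp)] at hz
      rw [show ψ u = _ from eq_neg_of_add_eq_zero_left hz, ← Finset.sum_neg_distrib]
      refine Finset.sum_congr rfl fun I _ => ?_
      rw [ih _ (hu ▸ subword_length_lt u I.1 I.2) _ rfl,
        Finset.prod_congr rfl fun i _ => hblock _ (List.get_mem _ i), Finset.card_compl,
        Fintype.card_fin]
      simp only [hψ, moments, subword, concatOn]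
      ring
  exact funext fun u => key _ u rfl

end Blocks

/-! ### The convolutions of functionals on words -/

section Convolution

variable {R α : Type*} [CommRing R]

/-- The additive convolution of functionals on all words. -/
def wordConv (ι : Independence) (f g : List α → R) : List α → R := colorSum (wordValue f g ι)

theorem wordConv_free_moments (κ κ' : α → List α → R) :
    wordConv .free (moments cauchy κ) (moments cauchy κ') = moments cauchy (κ + κ') := by
  rw [wordConv, wordValue, freeValue_moments]
  exact colorSum_moments colorSum_cauchy cauchy_add_right cauchy_add_left κ κ'

theorem wordConv_boolean_moments (κ κ' : α → List α → R) :
    wordConv .boolean (moments outer κ) (moments outer κ') = moments outer (κ + κ') := by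
  rw [wordConv, wordValue, booleanValue_moments]
  refine colorSum_moments (fun k c => ?_) (fun k c c' => ?_) (fun k k' c => ?_) κ κ'
  · rw [outer, colorSum_smul]
    rfl
  · simp [outer, add_smul]
  · simp [outer]

theorem exists_free_cumulants (f : List α → R) (hf : f [] = 1) : ∃ κ, moments cauchy κ = f :=
  exists_moments_eq (fun _ _ _ _ w => cauchy_congr w) cauchy_counit_right f hf

theorem exists_boolean_cumulants (f : List α → R) (hf : f [] = 1) : ∃ κ, moments outer κ = f :=
  exists_moments_eq (fun k k' c c' w hk hc => by simp [outer, hk w le_rfl, hc [] (by simp)])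
    (fun k => by simp [outer, counit]) f hf

/-- Removing the first letter acts as a derivation of the tensor convolution, which makes its
algebraic identities inductions on the word. -/
theorem wordConv_tensor_cons (f g : List α → R) (a : α) (w : List α) :
    wordConv .tensor f g (a :: w) = wordConv .tensor (fun v => f (a :: v)) g w +
      wordConv .tensor f (fun v => g (a :: v)) w := rfl

theorem wordConv_tensor_add_left (f f' g : List α → R) :
    wordConv .tensor (f + f') g = wordConv .tensor f g + wordConv .tensor f' g := by
  simp only [wordConv, wordValue, ← colorSum_add]
  congr 1
  funext u
  simp [tensorValue, add_mul]

theorem wordConv_tensor_add_right (f g g' : List α → R) :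
    wordConv .tensor f (g + g') = wordConv .tensor f g + wordConv .tensor f g' := by
  simp only [wordConv, wordValue, ← colorSum_add]
  congr 1
  funext u
  simp [tensorValue, mul_add]

theorem wordConv_tensor_comm (f g : List α → R) :
    wordConv .tensor f g = wordConv .tensor g f := by
  funext w
  induction w generalizing f g with
  | nil => exact mul_comm _ _
  | cons a w ih => rw [wordConv_tensor_cons, wordConv_tensor_cons, add_comm, ih f, ih _ g]

theorem wordConv_tensor_assoc (f g h : List α → R) :
    wordConv .tensor (wordConv .tensor f g) h = wordConv .tensor f (wordConv .tensor g h) := by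
  funext w
  induction w generalizing f g h with
  | nil => exact mul_assoc _ _ _
  | cons a w ih =>
    rw [wordConv_tensor_cons, wordConv_tensor_cons]
    simp only [wordConv_tensor_cons]
    have h1 := congrFun (wordConv_tensor_add_left (wordConv .tensor (fun v => f (a :: v)) g)
      (wordConv .tensor f fun v => g (a :: v)) h) w
    have h2 := congrFun (wordConv_tensor_add_right f (wordConv .tensor (fun v => g (a :: v)) h)
      (wordConv .tensor g fun v => h (a :: v))) w
    simp only [Pi.add_apply, Pi.add_def] at h1 h2
    rw [h1, h2, ih, ih, ih]
    ring

theorem wordConv_tensor_zero_right (f : List α → R) : wordConv .tensor f 0 = 0 := by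
  have h : wordValue f 0 .tensor = 0 := by
    funext u
    simp [wordValue, tensorValue]
  rw [wordConv, h, colorSum_zero]

theorem wordConv_nil (ι : Independence) {f g : List α → R} (hf : f [] = 1) (hg : g [] = 1) :
    wordConv ι f g [] = 1 := by
  cases ι
  · change f [] * g [] = 1
    simp [hf, hg]
  · change freeValue f g [] = 1
    rw [freeValue, if_pos rfl]
  · rfl

theorem wordConv_comm (ι : Independence) {f g : List α → R} (hf : f [] = 1) (hg : g [] = 1) :
    wordConv ι f g = wordConv ι g f := by
  cases ι
  · exact wordConv_tensor_comm f g
  · obtain ⟨κ, rfl⟩ := exists_free_cumulants f hf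
    obtain ⟨κ', rfl⟩ := exists_free_cumulants g hg
    rw [wordConv_free_moments, wordConv_free_moments, add_comm]
  · obtain ⟨κ, rfl⟩ := exists_boolean_cumulants f hf
    obtain ⟨κ', rfl⟩ := exists_boolean_cumulants g hg
    rw [wordConv_boolean_moments, wordConv_boolean_moments, add_comm]

theorem wordConv_assoc (ι : Independence) {f g h : List α → R} (hf : f [] = 1) (hg : g [] = 1)
    (hh : h [] = 1) : wordConv ι (wordConv ι f g) h = wordConv ι f (wordConv ι g h) := by
  cases ι
  · exact wordConv_tensor_assoc f g h
  · obtain ⟨κ, rfl⟩ := exists_free_cumulants f hf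
    obtain ⟨κ', rfl⟩ := exists_free_cumulants g hg
    obtain ⟨κ'', rfl⟩ := exists_free_cumulants h hh
    simp only [wordConv_free_moments, add_assoc]
  · obtain ⟨κ, rfl⟩ := exists_boolean_cumulants f hf
    obtain ⟨κ', rfl⟩ := exists_boolean_cumulants g hg
    obtain ⟨κ'', rfl⟩ := exists_boolean_cumulants h hh
    simp only [wordConv_boolean_moments, add_assoc]

theorem wordConv_counit (ι : Independence) {f : List α → R} (hf : f [] = 1) :
    wordConv ι f counit = f := by
  cases ι
  · clear hf
    funext w
    induction w generalizing f with
    | nil => exact mul_one _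
    | cons a w ih =>
      have := congrFun (wordConv_tensor_zero_right f) w
      rw [wordConv_tensor_cons, ih]
      change _ + wordConv .tensor f 0 w = _
      rw [this]
      simp
  · obtain ⟨κ, rfl⟩ := exists_free_cumulants f hf
    rw [← moments_zero (β := cauchy) cauchy_zero_left, wordConv_free_moments, add_zero]
  · obtain ⟨κ, rfl⟩ := exists_boolean_cumulants f hf
    rw [← moments_zero (β := outer) (fun c => by simp [outer]), wordConv_boolean_moments, add_zero]

/-! ### Locality, naturality and homogeneity -/

theorem length_xPart_add_yPart (u : List (α ⊕ α)) :
    (xPart u).length + (yPart u).length = u.length := by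
  induction u with
  | nil => rfl
  | cons a u ih =>
    obtain a | a := a
    · change (xPart u).length + 1 + (yPart u).length = u.length + 1
      omega
    · change (xPart u).length + ((yPart u).length + 1) = u.length + 1
      omega

theorem sum_length_blocks (u : List (α ⊕ α)) :
    ∑ i : Fin (blocks u).length, ((blocks u).get i).length = u.length := by
  conv_rhs => rw [← blocks_flatten u]
  rw [List.length_flatten]
  exact Fin.sum_univ_fun_getElem (blocks u) List.length

theorem length_subword (u : List (α ⊕ α)) (I : Finset (Fin (blocks u).length)) :
    (subword u I).length = ∑ i ∈ I, ((blocks u).get i).length := by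
  classical
  unfold subword
  rw [List.length_flatMap, ← List.sum_toFinset _ ((List.nodup_finRange _).filter _)]
  congr 1
  ext i
  simp

theorem length_le_of_mem_blocks {u v : List (α ⊕ α)} (hv : v ∈ blocks u) :
    v.length ≤ u.length := by
  conv_rhs => rw [← blocks_flatten u]
  exact (List.sublist_flatten_of_mem hv).length_le

theorem blockValue_congr {f f' g g' : List α → R} (v : List (α ⊕ α))
    (hf : ∀ w, w.length ≤ v.length → f w = f' w) (hg : ∀ w, w.length ≤ v.length → g w = g' w) :
    blockValue f g v = blockValue f' g' v := by
  have := length_xPart_add_yPart v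
  obtain _ | ⟨a | a, v⟩ := v
  · rfl
  · exact hf _ (by omega)
  · exact hg _ (by omega)

theorem freeValue_congr {f f' g g' : List α → R} (u : List (α ⊕ α))
    (hf : ∀ w, w.length ≤ u.length → f w = f' w) (hg : ∀ w, w.length ≤ u.length → g w = g' w) :
    freeValue f g u = freeValue f' g' u := by
  generalize hm : u.length = m
  induction m using Nat.strong_induction_on generalizing u with
  | _ m ih =>
    subst hm
    rw [freeValue, freeValue]
    congr 1
    refine Finset.sum_congr rfl fun I _ => ?_
    have hI := subword_length_lt u I.1 I.2
    rw [ih _ hI _ (fun w hw => hf w (by omega)) (fun w hw => hg w (by omega)) rfl]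
    congr 1
    refine Finset.prod_congr rfl fun i _ => ?_
    have hi := length_le_of_mem_blocks (List.get_mem (blocks u) i)
    exact blockValue_congr _ (fun w hw => hf w (by omega)) (fun w hw => hg w (by omega))

theorem wordValue_congr (ι : Independence) {f f' g g' : List α → R} (u : List (α ⊕ α))
    (hf : ∀ w, w.length ≤ u.length → f w = f' w) (hg : ∀ w, w.length ≤ u.length → g w = g' w) :
    wordValue f g ι u = wordValue f' g' ι u := by
  cases ι
  · have := length_xPart_add_yPart u
    change f _ * g _ = f' _ * g' _
    rw [hf _ (by omega), hg _ (by omega)]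
  · exact freeValue_congr u hf hg
  · change ((blocks u).map _).prod = ((blocks u).map _).prod
    congr 1
    refine List.map_congr_left fun v hv => ?_
    have hi := length_le_of_mem_blocks hv
    exact blockValue_congr _ (fun w hw => hf w (by omega)) (fun w hw => hg w (by omega))

/-- Locality is what makes truncation at length `n` compatible with the group law. -/
theorem wordConv_congr (ι : Independence) {f f' g g' : List α → R} (w : List α)
    (hf : ∀ v, v.length ≤ w.length → f v = f' v) (hg : ∀ v, v.length ≤ w.length → g v = g' v) :
    wordConv ι f g w = wordConv ι f' g' w :=
  colorSum_congr w fun u hu => wordValue_congr ι u (hu ▸ hf) (hu ▸ hg)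

theorem map_blockValue {S : Type*} [CommRing S] (φ : R →+* S) (f g : List α → R)
    (v : List (α ⊕ α)) : φ (blockValue f g v) = blockValue (φ ∘ f) (φ ∘ g) v := by
  obtain _ | ⟨a | a, v⟩ := v
  · exact map_one φ
  · rfl
  · rfl

theorem map_freeValue {S : Type*} [CommRing S] (φ : R →+* S) (f g : List α → R)
    (u : List (α ⊕ α)) : φ (freeValue f g u) = freeValue (φ ∘ f) (φ ∘ g) u := by
  generalize hm : u.length = m
  induction m using Nat.strong_induction_on generalizing u with
  | _ m ih =>
    subst hm
    rw [freeValue, freeValue, apply_ite φ, map_one, map_sum]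
    congr 1
    refine Finset.sum_congr rfl fun I _ => ?_
    simp only [map_mul, map_pow, map_neg, map_one, map_prod, map_blockValue,
      ih _ (subword_length_lt u I.1 I.2) _ rfl]

theorem map_wordConv {S : Type*} [CommRing S] (φ : R →+* S) (ι : Independence)
    (f g : List α → R) (w : List α) :
    φ (wordConv ι f g w) = wordConv ι (φ ∘ f) (φ ∘ g) w := by
  have hsum : ∀ (h : List (α ⊕ α) → R) (w : List α), φ (colorSum h w) = colorSum (φ ∘ h) w := by
    intro h w
    induction w generalizing h with
    | nil => rfl
    | cons a w ih =>
      simp only [colorSum, map_add, ih]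
      rfl
  rw [wordConv, hsum, wordConv]
  congr 1
  funext u
  cases ι
  · exact map_mul φ _ _
  · exact map_freeValue φ f g u
  · change φ (((blocks u).map _).prod) = ((blocks u).map _).prod
    rw [map_list_prod, List.map_map]
    congr 1
    exact List.map_congr_left fun v _ => map_blockValue φ f g v

variable {k : Type*} [CommRing k] [Algebra k R]

theorem blockValue_mem (𝒜 : ℕ → Submodule k R) [SetLike.GradedMonoid 𝒜] {f g : List α → R}
    (hf : ∀ w, f w ∈ 𝒜 w.length) (hg : ∀ w, g w ∈ 𝒜 w.length) {b : Bool} {v : List (α ⊕ α)}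
    (hv : ∀ a ∈ v, a.isLeft = b) : blockValue f g v ∈ 𝒜 v.length := by
  obtain _ | ⟨a | a, v⟩ := v
  · exact SetLike.GradedOne.one_mem
  · obtain rfl : true = b := by simpa using hv (Sum.inl a) List.mem_cons_self
    have := hf (xPart (Sum.inl a :: v))
    rwa [← List.length_map (f := Sum.inl (β := α)), map_inl_xPart _ hv] at this
  · obtain rfl : false = b := by simpa using hv (Sum.inr a) List.mem_cons_self
    have := hg (yPart (Sum.inr a :: v))
    rwa [← List.length_map (f := Sum.inr (α := α)), map_inr_yPart _ hv] at this

theorem blockValue_mem_of_mem_blocks (𝒜 : ℕ → Submodule k R) [SetLike.GradedMonoid 𝒜]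
    {f g : List α → R} (hf : ∀ w, f w ∈ 𝒜 w.length) (hg : ∀ w, g w ∈ 𝒜 w.length)
    {u v : List (α ⊕ α)} (hv : v ∈ blocks u) : blockValue f g v ∈ 𝒜 v.length := by
  obtain ⟨b, hb⟩ := exists_alternating_blocks u
  generalize blocks u = L at hb hv
  induction L generalizing b with
  | nil => simp at hv
  | cons w L ih =>
    rcases List.mem_cons.1 hv with rfl | hv
    · exact blockValue_mem 𝒜 hf hg hb.2.1
    · exact ih _ hb.2.2 hv

theorem freeValue_mem (𝒜 : ℕ → Submodule k R) [SetLike.GradedMonoid 𝒜] {f g : List α → R}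
    (hf : ∀ w, f w ∈ 𝒜 w.length) (hg : ∀ w, g w ∈ 𝒜 w.length) (u : List (α ⊕ α)) :
    freeValue f g u ∈ 𝒜 u.length := by
  classical
  generalize hm : u.length = m
  induction m using Nat.strong_induction_on generalizing u with
  | _ m ih =>
    subst hm
    rw [freeValue]
    split_ifs with hu
    · subst hu
      exact SetLike.GradedOne.one_mem
    refine Submodule.sum_mem _ fun I _ => ?_
    have h1 := ih _ (subword_length_lt u I.1 I.2) _ rfl
    have h2 := SetLike.prod_mem_graded 𝒜 (fun i => ((blocks u).get i).length)
      (fun i => blockValue f g ((blocks u).get i)) (F := I.1ᶜ)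
      (fun i _ => blockValue_mem_of_mem_blocks 𝒜 hf hg (List.get_mem _ i))
    have h3 := SetLike.mul_mem_graded h1 h2
    rw [length_subword, Finset.sum_add_sum_compl, sum_length_blocks] at h3
    rcases neg_one_pow_eq_or R ((blocks u).length - I.1.card + 1) with h | h <;> rw [h]
    · rwa [one_mul]
    · rw [neg_one_mul, neg_mul]
      exact Submodule.neg_mem _ h3

theorem wordConv_mem (𝒜 : ℕ → Submodule k R) [SetLike.GradedMonoid 𝒜] (ι : Independence)
    {f g : List α → R} (hf : ∀ w, f w ∈ 𝒜 w.length) (hg : ∀ w, g w ∈ 𝒜 w.length) (w : List α) :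
    wordConv ι f g w ∈ 𝒜 w.length := by
  -- The offset `d` counts the letters already stripped from the word, as the induction requires.
  have hsum : ∀ (d : ℕ) (h : List (α ⊕ α) → R), (∀ u, h u ∈ 𝒜 (d + u.length)) → ∀ w,
      colorSum h w ∈ 𝒜 (d + w.length) := by
    intro d h hh w
    induction w generalizing h d with
    | nil => exact hh []
    | cons a w ih =>
      have key : ∀ b : α ⊕ α, colorSum (fun u => h (b :: u)) w ∈ 𝒜 (d + (a :: w).length) := by
        intro b
        have := ih (d + 1) (fun u => h (b :: u)) fun u => by
          simpa [add_assoc, add_comm 1] using hh (b :: u)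
        simpa [add_assoc, add_comm 1] using this
      exact Submodule.add_mem _ (key _) (key _)
  have := hsum 0 (wordValue f g ι) (fun u => ?_) w
  · rwa [zero_add] at this
  rw [zero_add]
  cases ι
  · have := SetLike.mul_mem_graded (hf (xPart u)) (hg (yPart u))
    rwa [length_xPart_add_yPart] at this
  · exact freeValue_mem 𝒜 hf hg u
  · have := SetLike.list_prod_map_mem_graded (A := 𝒜) (blocks u) List.length (blockValue f g)
      fun v hv => blockValue_mem_of_mem_blocks 𝒜 hf hg hv
    rwa [← List.length_flatten, blocks_flatten] at this

end Convolution

/-! ### The convolutions of points -/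

section Points

variable {R : Type*} [CommRing R] {s n : ℕ}

theorem basisFreeMonoid_ofList (X : Type*) (u : List X) :
    FreeAlgebra.basisFreeMonoid R X (FreeMonoid.ofList u) = (u.map (FreeAlgebra.ι R)).prod := by
  simp [FreeAlgebra.basisFreeMonoid, FreeAlgebra.equivMonoidAlgebraFreeMonoid]

theorem universalProduct_addCoproduct (ι : Independence) (f g : List (Fin s) → R)
    (w : List (Fin s)) :
    universalProduct ι f g (addCoproduct R s (monomialOf R w)) = wordConv ι f g w := by
  have hL : ∀ u : List (Fin s ⊕ Fin s),
      universalProduct ι f g (u.map (FreeAlgebra.ι R)).prod = wordValue f g ι u := by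
    intro u
    rw [← basisFreeMonoid_ofList, universalProduct, Module.Basis.constr_basis]
    rfl
  -- The prefix `u` holds the letters whose factor `x_i + y_i` has already been expanded.
  have key : ∀ (w : List (Fin s)) (u : List (Fin s ⊕ Fin s)),
      universalProduct ι f g ((u.map (FreeAlgebra.ι R)).prod *
        addCoproduct R s (monomialOf R w)) = colorSum (fun v => wordValue f g ι (u ++ v)) w := by
    intro w
    induction w with
    | nil =>
      intro u
      simp [monomialOf, colorSum, hL]
    | cons a w ih =>
      intro u
      have h1 := ih (u ++ [Sum.inl a])
      have h2 := ih (u ++ [Sum.inr a])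
      simp only [List.append_assoc, List.singleton_append, List.map_append, List.map_cons,
        List.map_nil, List.prod_append, List.prod_cons, List.prod_nil, mul_one] at h1 h2
      rw [colorSum, ← h1, ← h2, ← map_add]
      congr 1
      simp only [monomialOf, List.map_cons, List.prod_cons, map_mul, addCoproduct,
        FreeAlgebra.lift_ι_apply]
      noncomm_ring
  simpa [wordConv] using key w []

theorem conv_apply (ι : Independence) (f g : Word s n → R) (w : Word s n) :
    conv ι f g w = wordConv ι (extend f) (extend g) w.1 :=
  universalProduct_addCoproduct ι _ _ _

theorem extend_nil (f : Word s n → R) : extend f [] = 1 := by simp [extend]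

theorem extend_coe (f : Word s n → R) (w : Word s n) : extend f w.1 = f w := by
  simp [extend, w.2]

theorem extend_zero : extend (0 : Word s n → R) = counit := by
  funext w
  cases w <;> simp [extend, counit]

/-- The length bound is needed: past `n` the left side is zero by convention, and the right side
need not be. -/
theorem extend_conv (ι : Independence) (f g : Word s n → R) (w : List (Fin s))
    (hw : w.length ≤ n) : extend (conv ι f g) w = wordConv ι (extend f) (extend g) w := by
  by_cases h : w = []
  · subst h
    rw [extend_nil, wordConv_nil ι (extend_nil f) (extend_nil g)]
  · rw [← conv_apply ι f g ⟨w, h, hw⟩]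
    exact extend_coe _ ⟨w, h, hw⟩

theorem conv_comm (ι : Independence) (f g : Word s n → R) : conv ι f g = conv ι g f := by
  funext w
  rw [conv_apply, conv_apply, wordConv_comm ι (extend_nil f) (extend_nil g)]

theorem conv_assoc (ι : Independence) (f g h : Word s n → R) :
    conv ι (conv ι f g) h = conv ι f (conv ι g h) := by
  funext w
  rw [conv_apply, conv_apply,
    wordConv_congr ι w.1 (fun v hv => extend_conv ι f g v (hv.trans w.2.2)) (fun _ _ => rfl),
    wordConv_congr ι w.1 (fun _ _ => rfl) (fun v hv => extend_conv ι g h v (hv.trans w.2.2)),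
    wordConv_assoc ι (extend_nil f) (extend_nil g) (extend_nil h)]

theorem conv_zero (ι : Independence) (f : Word s n → R) : conv ι f 0 = f := by
  funext w
  rw [conv_apply, extend_zero, wordConv_counit ι (extend_nil f), extend_coe]

theorem map_conv {S : Type*} [CommRing S] (φ : R →+* S) (ι : Independence) (f g : Word s n → R)
    (w : Word s n) : φ (conv ι f g w) = conv ι (φ ∘ f) (φ ∘ g) w := by
  have hext : ∀ f : Word s n → R, φ ∘ extend f = extend (φ ∘ f) := by
    intro f
    funext v
    simp only [extend, Function.comp_apply]
    split_ifs <;> simp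
  rw [conv_apply, conv_apply, map_wordConv, hext, hext]

theorem eval_groupLaw {k : Type*} [Field k] (ι : Independence) (f g : Word s n → k)
    (w : Word s n) : MvPolynomial.eval (Sum.elim f g) (groupLaw k ι s n w) = conv ι f g w := by
  rw [groupLaw, map_conv]
  congr 1 <;> funext v <;> simp

theorem isWeightedHomogeneous_groupLaw (k : Type*) [Field k] (ι : Independence)
    (w : Word s n) :
    MvPolynomial.IsWeightedHomogeneous (Sum.elim deg deg) (groupLaw k ι s n w) (deg w) := by
  have hext : ∀ (f : Word s n → MvPolynomial (Word s n ⊕ Word s n) k),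
      (∀ w, MvPolynomial.IsWeightedHomogeneous (Sum.elim deg deg) (f w) (deg w)) →
      ∀ v : List (Fin s), extend f v ∈
        MvPolynomial.weightedHomogeneousSubmodule k (Sum.elim deg deg) v.length := by
    intro f hf v
    unfold extend
    split_ifs with h1 h2
    · subst h1
      exact MvPolynomial.isWeightedHomogeneous_one k _
    · exact hf ⟨v, h2⟩
    · exact Submodule.zero_mem _
  have := MvPolynomial.WeightedHomogeneousSubmodule.gradedMonoid (R := k)
    (w := (Sum.elim deg deg : Word s n ⊕ Word s n → ℕ))
  rw [groupLaw, conv_apply]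
  exact wordConv_mem (MvPolynomial.weightedHomogeneousSubmodule k (Sum.elim deg deg)) ι
    (hext _ fun v => MvPolynomial.isWeightedHomogeneous_X k _ (Sum.inl v))
    (hext _ fun v => MvPolynomial.isWeightedHomogeneous_X k _ (Sum.inr v)) w.1

end Points

/-! ### Weighted homogeneous substitutions -/

section Substitution

variable {k W τ A : Type*} [Field k] [CommRing A] [Algebra k A]

theorem aeval_mem_graded (𝒜 : ℕ → Submodule k A) [SetLike.GradedMonoid 𝒜] {σ : τ → ℕ} {d : ℕ}
    {p : MvPolynomial τ k} (hp : MvPolynomial.IsWeightedHomogeneous σ p d) {g : τ → A}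
    (hg : ∀ i, g i ∈ 𝒜 (σ i)) : MvPolynomial.aeval g p ∈ 𝒜 d := by
  rw [MvPolynomial.aeval_def, MvPolynomial.eval₂_eq]
  refine Submodule.sum_mem _ fun m hm => ?_
  rw [← Algebra.smul_def]
  refine Submodule.smul_mem _ _ ?_
  have := SetLike.prod_mem_graded 𝒜 (fun i => m i • σ i) (fun i => g i ^ m i) (F := m.support)
    fun i _ => SetLike.pow_mem_graded _ (hg i)
  rwa [show ∑ i ∈ m.support, m i • σ i = d from
    hp (MvPolynomial.mem_support_iff.1 hm) ▸ (Finsupp.weight_apply σ m).symm] at this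

theorem aeval_isWeightedHomogeneous {ρ : τ → ℕ} {σ : W → ℕ} {d : ℕ}
    {p : MvPolynomial τ k} (hp : MvPolynomial.IsWeightedHomogeneous ρ p d)
    {g : τ → MvPolynomial W k} (hg : ∀ i, MvPolynomial.IsWeightedHomogeneous σ (g i) (ρ i)) :
    MvPolynomial.IsWeightedHomogeneous σ (MvPolynomial.aeval g p) d := by
  have := MvPolynomial.WeightedHomogeneousSubmodule.gradedMonoid (R := k) (w := σ)
  exact aeval_mem_graded (MvPolynomial.weightedHomogeneousSubmodule k σ) hp hg

theorem eval_smul_of_isWeightedHomogeneous {σ : τ → ℕ} {d : ℕ}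
    {p : MvPolynomial τ k} (hp : MvPolynomial.IsWeightedHomogeneous σ p d) (c : k) (x : τ → k) :
    MvPolynomial.eval (fun i => c ^ σ i * x i) p = c ^ d * MvPolynomial.eval x p := by
  rw [MvPolynomial.eval_eq, MvPolynomial.eval_eq, Finset.mul_sum]
  refine Finset.sum_congr rfl fun m hm => ?_
  rw [← hp (MvPolynomial.mem_support_iff.1 hm), Finsupp.weight_apply, Finsupp.sum,
    ← Finset.prod_pow_eq_pow_sum]
  simp_rw [mul_pow, Finset.prod_mul_distrib, ← pow_mul, smul_eq_mul, mul_comm (m _)]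
  ring

/-- The chain rule for a derivation and a polynomial substitution. -/
theorem derivation_aeval [Fintype τ] (D : Derivation k A A) (g : τ → A) (p : MvPolynomial τ k) :
    D (MvPolynomial.aeval g p) =
      ∑ i, MvPolynomial.aeval g (MvPolynomial.pderiv i p) * D (g i) := by
  classical
  induction p using MvPolynomial.induction_on with
  | C a => simp
  | add p q hp hq => simp [hp, hq, add_mul, Finset.sum_add_distrib]
  | mul_X p i hp =>
    simp [hp, MvPolynomial.pderiv_X, add_mul, Finset.sum_add_distrib, Pi.single_apply,
      Finset.mul_sum, apply_ite (MvPolynomial.aeval g)]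
    exact Finset.sum_congr rfl fun j _ => (mul_assoc _ _ _).symm

theorem aeval_congr_vars {p : MvPolynomial τ k} {g g' : τ → A} (h : ∀ i ∈ p.vars, g i = g' i) :
    MvPolynomial.aeval g p = MvPolynomial.aeval g' p :=
  MvPolynomial.eval₂Hom_congr' rfl (fun i hi _ => h i hi) rfl

theorem eq_of_aeval_eq [Infinite k] {p q : MvPolynomial τ k}
    (h : ∀ x : τ → k, MvPolynomial.aeval x p = MvPolynomial.aeval x q) : p = q :=
  MvPolynomial.funext h

end Substitution

/-! ### Antiderivatives -/

section Antiderivative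

variable (k : Type*) {R : Type*} [Field k] [CommRing R] [Algebra k R]

/-- The antiderivative without constant term. -/
noncomputable def antideriv (p : Polynomial R) : Polynomial R :=
  p.sum fun i a => Polynomial.monomial (i + 1) (((i : k) + 1)⁻¹ • a)

theorem coeff_antideriv_zero (p : Polynomial R) : (antideriv k p).coeff 0 = 0 := by
  simp [antideriv, Polynomial.sum_def, Polynomial.coeff_monomial]

theorem coeff_antideriv_succ (p : Polynomial R) (i : ℕ) :
    (antideriv k p).coeff (i + 1) = ((i : k) + 1)⁻¹ • p.coeff i := by
  simp only [antideriv, Polynomial.sum_def, Polynomial.finsetSum_coeff,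
    Polynomial.coeff_monomial, add_left_inj]
  rw [Finset.sum_ite_eq' p.support i]
  split_ifs with h
  · rfl
  · rw [Polynomial.notMem_support_iff.1 h, smul_zero]

theorem antideriv_add (p q : Polynomial R) :
    antideriv k (p + q) = antideriv k p + antideriv k q := by
  ext i
  obtain _ | i := i
  · simp [coeff_antideriv_zero]
  · simp [coeff_antideriv_succ]

theorem antideriv_C (a : R) : antideriv k (Polynomial.C a) = Polynomial.C a * Polynomial.X := by
  ext i
  obtain _ | _ | i := i
  · simp [coeff_antideriv_zero]
  · simp [coeff_antideriv_succ]
  · rw [coeff_antideriv_succ, Polynomial.coeff_C_succ, smul_zero, Polynomial.coeff_mul_X,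
      Polynomial.coeff_C_succ]

theorem map_antideriv {S : Type*} [CommRing S] [Algebra k S] (φ : R →ₐ[k] S) (p : Polynomial R) :
    (antideriv k p).map (φ : R →+* S) = antideriv k (p.map (φ : R →+* S)) := by
  ext i
  obtain _ | i := i
  · simp [coeff_antideriv_zero]
  · simp [coeff_antideriv_succ]

theorem derivative_antideriv [CharZero k] (p : Polynomial R) :
    Polynomial.derivative (antideriv k p) = p := by
  ext i
  have h : (i : k) + 1 ≠ 0 := Nat.cast_add_one_ne_zero i
  rw [Polynomial.coeff_derivative, coeff_antideriv_succ, mul_comm,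
    show ((i : R) + 1) = algebraMap k R ((i : k) + 1) by simp, ← Algebra.smul_def, smul_smul,
    mul_inv_cancel₀ h, one_smul]

theorem antideriv_derivative [CharZero k] (p : Polynomial R) (hp : p.eval 0 = 0) :
    antideriv k (Polynomial.derivative p) = p := by
  ext i
  obtain _ | i := i
  · rw [coeff_antideriv_zero, Polynomial.coeff_zero_eq_eval_zero, hp]
  · have h : (i : k) + 1 ≠ 0 := Nat.cast_add_one_ne_zero i
    rw [coeff_antideriv_succ, Polynomial.coeff_derivative, mul_comm,
      show ((i : R) + 1) = algebraMap k R ((i : k) + 1) by simp, ← Algebra.smul_def, smul_smul,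
      inv_mul_cancel₀ h, one_smul]

end Antiderivative

/-! ### Homogeneous commutative polynomial group laws -/

section Law

variable {k W R S : Type*} [Field k] [CommRing R] [Algebra k R] [CommRing S] [Algebra k S]

/-- The operation given by the polynomials `F`. -/
noncomputable def polyOp (F : W → MvPolynomial (W ⊕ W) k) (x y : W → R) : W → R :=
  fun w => MvPolynomial.aeval (Sum.elim x y) (F w)

/-- `F` is an associative and commutative polynomial law with unit `0`, homogeneous for the
positive weights `σ`. -/
structure IsHomogeneousLaw (σ : W → ℕ) (F : W → MvPolynomial (W ⊕ W) k) : Prop where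
  pos : ∀ w, 1 ≤ σ w
  homogeneous : ∀ w, MvPolynomial.IsWeightedHomogeneous (Sum.elim σ σ) (F w) (σ w)
  comm : ∀ x y : W → k, polyOp F x y = polyOp F y x
  assoc : ∀ x y z : W → k, polyOp F (polyOp F x y) z = polyOp F x (polyOp F y z)
  zero : ∀ x : W → k, polyOp F x 0 = x

theorem map_polyOp (F : W → MvPolynomial (W ⊕ W) k) (φ : R →ₐ[k] S) (x y : W → R) :
    φ ∘ polyOp F x y = polyOp F (φ ∘ x) (φ ∘ y) := by
  funext w
  rw [Function.comp_apply, polyOp, polyOp, ← AlgHom.comp_apply, MvPolynomial.comp_aeval]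
  congr 2
  funext i
  obtain i | i := i <;> rfl

theorem map_aeval {τ : Type*} (φ : R →ₐ[k] S) (g : τ → R) (p : MvPolynomial τ k) :
    φ (MvPolynomial.aeval g p) = MvPolynomial.aeval (φ ∘ g) p := by
  rw [← AlgHom.comp_apply, MvPolynomial.comp_aeval]
  rfl

theorem aeval_jacobian (F : W → MvPolynomial (W ⊕ W) k) (w u : W) (x : W → R) :
    MvPolynomial.aeval x (jacobian F w u) =
      MvPolynomial.aeval (Sum.elim x 0) (MvPolynomial.pderiv (Sum.inr u) (F w)) := by
  rw [jacobian, map_aeval]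
  congr 2
  funext i
  obtain i | i := i <;> simp

variable {σ : W → ℕ} {F : W → MvPolynomial (W ⊕ W) k}

/-- Over an infinite field an identity at all points is an identity of polynomials, so it
specializes to every `k`-algebra. The curves require this over `k[t]`; the unit and associativity
laws are transferred in the same way. -/
theorem IsHomogeneousLaw.polyOp_comm [Infinite k] (hF : IsHomogeneousLaw σ F) (x y : W → R) :
    polyOp F x y = polyOp F y x := by
  let X : W → MvPolynomial (W ⊕ W) k := fun u => MvPolynomial.X (Sum.inl u)
  let Y : W → MvPolynomial (W ⊕ W) k := fun u => MvPolynomial.X (Sum.inr u)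
  have h : polyOp F X Y = polyOp F Y X := funext fun w => eq_of_aeval_eq fun a => by
    have := congrFun (hF.comm (MvPolynomial.aeval a ∘ X) (MvPolynomial.aeval a ∘ Y)) w
    rwa [← map_polyOp, ← map_polyOp] at this
  have := congrArg (MvPolynomial.aeval (Sum.elim x y) ∘ ·) h
  simp only [map_polyOp] at this
  rwa [show MvPolynomial.aeval (Sum.elim x y) ∘ X = x from funext fun u => by simp [X],
    show MvPolynomial.aeval (Sum.elim x y) ∘ Y = y from funext fun u => by simp [Y]] at this

theorem IsHomogeneousLaw.polyOp_zero [Infinite k] (hF : IsHomogeneousLaw σ F) (x : W → R) :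
    polyOp F x 0 = x := by
  have h : polyOp F (MvPolynomial.X : W → MvPolynomial W k) 0 = MvPolynomial.X :=
    funext fun w => eq_of_aeval_eq fun a => by
      have := congrFun (hF.zero (MvPolynomial.aeval (R := k) a ∘ MvPolynomial.X)) w
      rwa [show (0 : W → k) = MvPolynomial.aeval a ∘ (0 : W → MvPolynomial W k) from
        funext fun u => (map_zero (MvPolynomial.aeval a)).symm, ← map_polyOp] at this
  have := congrArg (MvPolynomial.aeval x ∘ ·) h
  simp only [map_polyOp] at this
  rwa [show MvPolynomial.aeval (R := k) x ∘ MvPolynomial.X = x from funext fun u => by simp,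
    show MvPolynomial.aeval (R := k) x ∘ (0 : W → MvPolynomial W k) = 0 from
      funext fun u => map_zero _] at this

theorem IsHomogeneousLaw.polyOp_assoc [Infinite k] (hF : IsHomogeneousLaw σ F) (x y z : W → R) :
    polyOp F (polyOp F x y) z = polyOp F x (polyOp F y z) := by
  let X : W → MvPolynomial (W ⊕ (W ⊕ W)) k := fun u => MvPolynomial.X (Sum.inl u)
  let Y : W → MvPolynomial (W ⊕ (W ⊕ W)) k := fun u => MvPolynomial.X (Sum.inr (Sum.inl u))
  let Z : W → MvPolynomial (W ⊕ (W ⊕ W)) k := fun u => MvPolynomial.X (Sum.inr (Sum.inr u))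
  have h : polyOp F (polyOp F X Y) Z = polyOp F X (polyOp F Y Z) :=
    funext fun w => eq_of_aeval_eq fun a => by
      have := congrFun (hF.assoc (MvPolynomial.aeval a ∘ X) (MvPolynomial.aeval a ∘ Y)
        (MvPolynomial.aeval a ∘ Z)) w
      rwa [← map_polyOp, ← map_polyOp, ← map_polyOp, ← map_polyOp] at this
  have := congrArg (MvPolynomial.aeval (Sum.elim x (Sum.elim y z)) ∘ ·) h
  simp only [map_polyOp] at this
  rwa [show MvPolynomial.aeval (Sum.elim x (Sum.elim y z)) ∘ X = x from
      funext fun u => by simp [X],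
    show MvPolynomial.aeval (Sum.elim x (Sum.elim y z)) ∘ Y = y from
      funext fun u => by simp [Y],
    show MvPolynomial.aeval (Sum.elim x (Sum.elim y z)) ∘ Z = z from
      funext fun u => by simp [Z]] at this

/-- The left translation by `x` maps the left-invariant vector fields at `y` to those at
the product of `x` and `y`. -/
theorem IsHomogeneousLaw.sum_pderiv_mul_jacobian [Infinite k] [Fintype W]
    (hF : IsHomogeneousLaw σ F) (x y : W → R) (w u : W) :
    ∑ t, MvPolynomial.aeval (Sum.elim x y) (MvPolynomial.pderiv (Sum.inr t) (F w)) *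
        MvPolynomial.aeval y (jacobian F t u) =
      MvPolynomial.aeval (polyOp F x y) (jacobian F w u) := by
  classical
  let X : W → MvPolynomial (W ⊕ (W ⊕ W)) k := fun u => MvPolynomial.X (Sum.inl u)
  let Y : W → MvPolynomial (W ⊕ (W ⊕ W)) k := fun u => MvPolynomial.X (Sum.inr (Sum.inl u))
  let Z : W → MvPolynomial (W ⊕ (W ⊕ W)) k := fun u => MvPolynomial.X (Sum.inr (Sum.inr u))
  let D := MvPolynomial.pderiv (R := k) (Sum.inr (Sum.inr u) : W ⊕ (W ⊕ W))
  have hX : ∀ t, D (X t) = 0 := fun t => MvPolynomial.pderiv_X_of_ne (by simp)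
  have hY : ∀ t, D (Y t) = 0 := fun t => MvPolynomial.pderiv_X_of_ne (by simp)
  have hZ : ∀ t, D (Z t) = if t = u then 1 else 0 := fun t => by
    simp [D, Z, MvPolynomial.pderiv_X, Pi.single_apply]
  have hD : ∀ a b : W → MvPolynomial (W ⊕ (W ⊕ W)) k, ∀ w, D (polyOp F a b w) =
      ∑ t, MvPolynomial.aeval (Sum.elim a b) (MvPolynomial.pderiv (Sum.inl t) (F w)) * D (a t) +
      ∑ t, MvPolynomial.aeval (Sum.elim a b) (MvPolynomial.pderiv (Sum.inr t) (F w)) * D (b t) :=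
    fun a b w => by
      rw [polyOp, derivation_aeval, Fintype.sum_sum_type]
      rfl
  -- Associativity of generic points is differentiated in `Z_u`; the map `φ` below then sets `X =
  -- x`, `Y = y` and `Z = 0`.
  have h := congrArg D (congrFun (hF.polyOp_assoc X Y Z) w)
  simp only [hD, hX, hY, hZ, mul_zero, Finset.sum_const_zero, zero_add, add_zero, mul_ite, mul_one,
    Finset.sum_ite_eq', Finset.mem_univ, if_true] at h
  let φ := MvPolynomial.aeval (R := k) (Sum.elim x (Sum.elim y (0 : W → R)))
  have pX : φ ∘ X = x := funext fun u => by simp [φ, X]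
  have pY : φ ∘ Y = y := funext fun u => by simp [φ, Y]
  have pZ : φ ∘ Z = 0 := funext fun u => by simp [φ, Z]
  have h' := congrArg φ h
  simp only [map_sum, map_mul, map_aeval, Sum.comp_elim, map_polyOp, pX, pY, pZ,
    hF.polyOp_zero] at h'
  simp only [aeval_jacobian]
  exact h'.symm

/-- Commutativity makes `F w` invariant under swapping the variables, so derivatives in the first
argument reduce to left invariance as well. -/
theorem IsHomogeneousLaw.aeval_pderiv_inl [Infinite k] (hF : IsHomogeneousLaw σ F)
    (x y : W → R) (w u : W) :
    MvPolynomial.aeval (Sum.elim x y) (MvPolynomial.pderiv (Sum.inl u) (F w)) =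
      MvPolynomial.aeval (Sum.elim y x) (MvPolynomial.pderiv (Sum.inr u) (F w)) := by
  have h : F w = MvPolynomial.rename Sum.swap (F w) := eq_of_aeval_eq fun a => by
    have := congrFun (hF.comm (a ∘ Sum.inl) (a ∘ Sum.inr)) w
    rw [MvPolynomial.aeval_rename]
    rw [polyOp, polyOp, Sum.elim_comp_inl_inr] at this
    rw [this]
    congr 2
    funext i
    cases i <;> rfl
  conv_lhs => rw [h, show (Sum.inl u : W ⊕ W) = Sum.swap (Sum.inr u) from rfl,
    MvPolynomial.pderiv_rename Sum.swap_leftInverse.injective, MvPolynomial.aeval_rename]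
  congr 2
  funext i
  cases i <;> rfl

/-- If `X_t` occurs in the entry `(w, u)`, then `F w` has a monomial divisible by `X_t Y_u`; its
weight `σ w` is at least `σ t + σ u`. -/
theorem IsHomogeneousLaw.aeval_jacobian_congr (hF : IsHomogeneousLaw σ F) {w u : W} {x y : W → R}
    (h : ∀ t, σ t + σ u ≤ σ w → x t = y t) :
    MvPolynomial.aeval x (jacobian F w u) = MvPolynomial.aeval y (jacobian F w u) := by
  rw [aeval_jacobian, aeval_jacobian]
  refine aeval_congr_vars fun i hi => ?_
  obtain t | t := i
  swap
  · rfl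
  refine h t ?_
  obtain ⟨m, hm, ht⟩ := (MvPolynomial.mem_vars_iff_mem_support _).1 hi
  have hc : MvPolynomial.coeff (m + Finsupp.single (Sum.inr u) 1) (F w) ≠ 0 := by
    intro h0
    rw [MvPolynomial.mem_support_iff, MvPolynomial.coeff_pderiv, h0] at hm
    simp at hm
  have h1 := hF.homogeneous w hc
  rw [map_add, Finsupp.weight_single, one_smul, Sum.elim_inr] at h1
  have h2 := Finsupp.le_weight_of_ne_zero' (Sum.elim σ σ) (Finsupp.mem_support_iff.1 ht)
  rw [Sum.elim_inl] at h2
  omega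

/-- Positivity of the weights leaves no room for a variable, so the entry is constant. Its value at
the origin is found by differentiating `F(0, X) = X`. -/
theorem IsHomogeneousLaw.aeval_jacobian_of_le [Infinite k] [DecidableEq W] [Fintype W]
    (hF : IsHomogeneousLaw σ F) {w u : W} (h : σ w ≤ σ u) (x : W → R) :
    MvPolynomial.aeval x (jacobian F w u) = if u = w then 1 else 0 := by
  have h1 : MvPolynomial.aeval (0 : W → k) (jacobian F w u) = if u = w then 1 else 0 := by
    have h2 := congrArg (MvPolynomial.pderiv u) (congrFun (hF.polyOp_comm
      (0 : W → MvPolynomial W k) MvPolynomial.X) w)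
    rw [hF.polyOp_zero, polyOp, derivation_aeval, Fintype.sum_sum_type] at h2
    simp only [Sum.elim_inl, Sum.elim_inr, Pi.zero_apply, map_zero, mul_zero,
      Finset.sum_const_zero, zero_add, MvPolynomial.pderiv_X, Pi.single_apply, mul_ite, mul_one,
      Finset.sum_ite_eq', Finset.mem_univ, if_true] at h2
    have h3 := congrArg (MvPolynomial.aeval (0 : W → k)) h2
    rw [map_aeval] at h3
    rw [aeval_jacobian]
    rw [Sum.comp_elim, show MvPolynomial.aeval (0 : W → k) ∘ (0 : W → MvPolynomial W k) = 0 from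
      funext fun u => map_zero _, show MvPolynomial.aeval (R := k) (0 : W → k) ∘ MvPolynomial.X = 0
      from funext fun u => by simp] at h3
    rw [h3]
    by_cases huw : u = w
    · rw [if_pos huw, if_pos huw.symm, map_one]
    · rw [if_neg huw, if_neg (Ne.symm huw), map_zero]
  rw [hF.aeval_jacobian_congr (y := Algebra.ofId k R ∘ (0 : W → k)) fun t ht => ?_, ← map_aeval, h1]
  · split_ifs <;> simp
  · have := hF.pos t
    omega

theorem IsHomogeneousLaw.isHomogeneousGroup (hF : IsHomogeneousLaw σ F) :
    IsHomogeneousGroup (k := k) σ (polyOp F) := by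
  refine ⟨hF.pos, fun c hc => ⟨⟨fun x y h => ?_, fun y => ⟨fun w => (c ^ σ w)⁻¹ * y w, ?_⟩⟩,
    fun x y => ?_⟩⟩
  · funext w
    exact mul_left_cancel₀ (pow_ne_zero _ hc) (congrFun h w)
  · funext w
    exact mul_inv_cancel_left₀ (pow_ne_zero _ hc) _
  · funext w
    have := eval_smul_of_isWeightedHomogeneous (hF.homogeneous w) c (Sum.elim x y)
    rw [show (fun i => c ^ Sum.elim σ σ i * Sum.elim x y i) =
      Sum.elim (fun w => c ^ σ w * x w) fun w => c ^ σ w * y w from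
        funext fun i => by cases i <;> rfl] at this
    exact this.symm

theorem IsHomogeneousPolynomialMap.comp {φ ψ : (W → k) → W → k}
    (hφ : IsHomogeneousPolynomialMap σ φ) (hψ : IsHomogeneousPolynomialMap σ ψ) :
    IsHomogeneousPolynomialMap σ (φ ∘ ψ) := by
  obtain ⟨P, hP, hP'⟩ := hφ
  obtain ⟨Q, hQ, hQ'⟩ := hψ
  refine ⟨fun w => MvPolynomial.aeval Q (P w), fun w => aeval_isWeightedHomogeneous (hP w) hQ,
    fun x w => ?_⟩
  rw [Function.comp_apply, hP', show ψ x = MvPolynomial.aeval x ∘ Q from funext (hQ' x)]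
  exact (map_aeval (MvPolynomial.aeval x) Q (P w)).symm

end Law

/-! ### Integral curves -/

section Curves

variable {k W R S : Type*} [Field k] [Fintype W] [CommRing R] [Algebra k R] [CommRing S]
  [Algebra k S]

/-- The Picard operator of the left-invariant vector field with coordinates `v`. -/
noncomputable def picard (F : W → MvPolynomial (W ⊕ W) k) (v : W → R) (γ : W → Polynomial R) :
    W → Polynomial R :=
  fun w => antideriv k (∑ u, Polynomial.C (v u) * MvPolynomial.aeval γ (jacobian F w u))

/-- The integral curve from the origin of the left-invariant vector field with coordinates `v`. -/
noncomputable def curve (σ : W → ℕ) (F : W → MvPolynomial (W ⊕ W) k) (v : W → R) :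
    W → Polynomial R :=
  triangularFix σ (picard F v) 0

/-- The difference between the value at time `1` of the integral curve and the identity. -/
noncomputable def expRemainder (σ : W → ℕ) (F : W → MvPolynomial (W ⊕ W) k) (v : W → R) : W → R :=
  fun w => (curve σ F v w).eval 1 - v w

/-- The polynomials of the exponential map. -/
noncomputable def expPoly (σ : W → ℕ) (F : W → MvPolynomial (W ⊕ W) k) (w : W) : MvPolynomial W k :=
  (curve σ F (MvPolynomial.X : W → MvPolynomial W k) w).eval 1

/-- The polynomials of the logarithm. -/
noncomputable def logPoly (σ : W → ℕ) (F : W → MvPolynomial (W ⊕ W) k) : W → MvPolynomial W k :=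
  triangularFix σ (fun x => MvPolynomial.X - expRemainder σ F x) 0

/-- The antiderivative without constant term encodes the differential equation and the initial
condition at once. -/
theorem isIntegralCurve_iff [CharZero k] (F : W → MvPolynomial (W ⊕ W) k) (v : W → k)
    (γ : W → Polynomial k) : IsIntegralCurve F v γ ↔ picard F v γ = γ := by
  constructor
  · rintro ⟨h0, h⟩
    funext w
    rw [picard, ← h w, antideriv_derivative k _ (h0 w)]
  · intro h
    refine ⟨fun w => ?_, fun w => ?_⟩
    · rw [← h, picard, ← Polynomial.coeff_zero_eq_eval_zero, coeff_antideriv_zero]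
    · conv_lhs => rw [← h, picard, derivative_antideriv]

variable {σ : W → ℕ} {F : W → MvPolynomial (W ⊕ W) k}

/-- The entry `(w, u)` involves only degrees up to `σ w - σ u`, which is below `σ w` since `σ u ≥
1`. -/
theorem IsHomogeneousLaw.isTriangular_picard (hF : IsHomogeneousLaw σ F) (v : W → R) :
    IsTriangular σ (picard F v) := fun x y w h => by
  unfold picard
  congr 1
  refine Finset.sum_congr rfl fun u _ => ?_
  rw [hF.aeval_jacobian_congr fun t ht => h t (by have := hF.pos u; omega)]

theorem IsHomogeneousLaw.picard_curve (hF : IsHomogeneousLaw σ F) (v : W → R) :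
    picard F v (curve σ F v) = curve σ F v :=
  (hF.isTriangular_picard v).fixed 0

theorem IsHomogeneousLaw.existsUnique_isIntegralCurve [CharZero k] (hF : IsHomogeneousLaw σ F)
    (v : W → k) : ∃! γ, IsIntegralCurve F v γ :=
  ⟨curve σ F v, (isIntegralCurve_iff F v _).2 (hF.picard_curve v), fun γ hγ =>
    (hF.isTriangular_picard v).eq_of_fixed ((isIntegralCurve_iff F v γ).1 hγ) (hF.picard_curve v)⟩

theorem IsHomogeneousLaw.expMap_apply [CharZero k] (hF : IsHomogeneousLaw σ F) (v : W → k) (w : W) :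
    expMap F v w = (curve σ F v w).eval 1 := by
  have h : ∃ γ, IsIntegralCurve F v γ := (hF.existsUnique_isIntegralCurve v).exists
  rw [expMap, dif_pos h, (hF.existsUnique_isIntegralCurve v).unique h.choose_spec
    ((isIntegralCurve_iff F v _).2 (hF.picard_curve v))]

/-- The image of the curve is a fixed point of the Picard operator over `S`, so uniqueness applies.
Every curve is therefore a specialization of the generic one, which makes the exponential
polynomial. -/
theorem IsHomogeneousLaw.map_curve (hF : IsHomogeneousLaw σ F) (φ : R →ₐ[k] S) (v : W → R) (w : W) :
    (curve σ F v w).map (φ : R →+* S) = curve σ F (φ ∘ v) w := by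
  refine congrFun ((hF.isTriangular_picard (φ ∘ v)).eq_of_fixed
    (x := fun w => (curve σ F v w).map (φ : R →+* S)) (funext fun w => ?_) (hF.picard_curve _)) w
  conv_rhs => rw [← hF.picard_curve v, picard, map_antideriv, Polynomial.map_sum]
  rw [picard]
  congr 1
  refine Finset.sum_congr rfl fun u _ => ?_
  rw [Polynomial.map_mul, Polynomial.map_C]
  congr 1
  exact (map_aeval (Polynomial.mapAlgHom φ) (curve σ F v) (jacobian F w u)).symm

theorem IsHomogeneousLaw.curve_eval_one (hF : IsHomogeneousLaw σ F) (v : W → R) (w : W) :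
    (curve σ F v w).eval 1 = MvPolynomial.aeval v (expPoly σ F w) := by
  have h := hF.map_curve (MvPolynomial.aeval v) (MvPolynomial.X : W → MvPolynomial W k) w
  rw [show MvPolynomial.aeval (R := k) v ∘ MvPolynomial.X = v from funext fun u => by simp] at h
  rw [← h, expPoly, Polynomial.eval_one_map]
  rfl

/-! ### Triangularity and inversion of the exponential -/

theorem IsHomogeneousLaw.curve_congr [Infinite k] (hF : IsHomogeneousLaw σ F) {x y : W → R} {d : ℕ}
    (h : ∀ u, σ u < d → x u = y u) (w : W) (hw : σ w < d) : curve σ F x w = curve σ F y w := by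
  classical
  generalize hm : σ w = m
  induction m using Nat.strong_induction_on generalizing w with
  | _ m ih =>
    subst hm
    rw [← hF.picard_curve x, ← hF.picard_curve y]
    refine congrArg (antideriv k) (Finset.sum_congr rfl fun u _ => ?_)
    by_cases hu : σ u < d
    · rw [h u hu, hF.aeval_jacobian_congr fun t ht =>
        ih (σ t) (by have := hF.pos u; omega) t (by have := hF.pos u; omega) rfl]
    -- Here `σ u` exceeds `σ w`, so the Jacobian entry is off the diagonal and vanishes: high
    -- coordinates of the vector field have no effect.
    · have huw : u ≠ w := by
        rintro rfl
        exact hu hw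
      rw [hF.aeval_jacobian_of_le (by omega), hF.aeval_jacobian_of_le (by omega), if_neg huw,
        mul_zero, mul_zero]

/-- Once the lower coordinates agree, changing `v w` alters the component at `w` only by a linear
term in `t`, because the diagonal of the Jacobian is one. Subtracting `v w` at time 1 removes this
dependence. -/
theorem IsHomogeneousLaw.isTriangular_expRemainder [Infinite k] (hF : IsHomogeneousLaw σ F) :
    IsTriangular σ (expRemainder σ F : (W → R) → W → R) := fun x y w h => by
  classical
  have hc := hF.curve_congr h
  have key : curve σ F x w = curve σ F y w + Polynomial.C (x w - y w) * Polynomial.X := by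
    rw [← antideriv_C k]
    conv_lhs => rw [← hF.picard_curve x, picard]
    conv_rhs => rw [← hF.picard_curve y, picard, ← antideriv_add]
    congr 1
    have hs : Polynomial.C (x w - y w) = ∑ u, if u = w then Polynomial.C (x w - y w) else 0 := by
      simp
    rw [hs, ← Finset.sum_add_distrib]
    refine Finset.sum_congr rfl fun u _ => ?_
    by_cases hu : σ u < σ w
    · have huw : u ≠ w := by
        rintro rfl
        exact lt_irrefl _ hu
      rw [if_neg huw, add_zero, h u hu, hF.aeval_jacobian_congr fun t ht =>
        hc t (by have := hF.pos u; omega)]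
    · rw [hF.aeval_jacobian_of_le (by omega), hF.aeval_jacobian_of_le (by omega)]
      split_ifs with huw
      · rw [huw, map_sub]
        ring
      · simp
  simp only [expRemainder, key, Polynomial.eval_add, Polynomial.eval_mul, Polynomial.eval_C,
    Polynomial.eval_X]
  ring

theorem expRemainder_add (σ : W → ℕ) (F : W → MvPolynomial (W ⊕ W) k) (v : W → R) (w : W) :
    v w + expRemainder σ F v w = (curve σ F v w).eval 1 := by
  simp [expRemainder]

theorem IsHomogeneousLaw.isTriangular_sub_expRemainder [Infinite k] (hF : IsHomogeneousLaw σ F)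
    (y : W → R) : IsTriangular σ fun x => y - expRemainder σ F x := fun x x' w h => by
  simp only [Pi.sub_apply, hF.isTriangular_expRemainder x x' w h]

theorem IsHomogeneousLaw.expMap_injective [CharZero k] (hF : IsHomogeneousLaw σ F) :
    Function.Injective (expMap F) := fun x y h => by
  have key : ∀ z : W → k, expMap F z - expRemainder σ F z = z := fun z => funext fun w => by
    rw [Pi.sub_apply, hF.expMap_apply, ← expRemainder_add, add_sub_cancel_right]
  exact (hF.isTriangular_sub_expRemainder (expMap F x)).eq_of_fixed (key x) (h ▸ key y)

/-- The fixed-point equation for `logPoly` says that the generic point of `k[X]` is the exponential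
of `logPoly`; it is then evaluated at `y`. -/
theorem IsHomogeneousLaw.expMap_logPoly [CharZero k] (hF : IsHomogeneousLaw σ F) (y : W → k) :
    expMap F (fun w => MvPolynomial.eval y (logPoly σ F w)) = y := by
  funext w
  have h := congrFun ((hF.isTriangular_sub_expRemainder
    (MvPolynomial.X : W → MvPolynomial W k)).fixed 0) w
  change MvPolynomial.X w - expRemainder σ F (logPoly σ F) w = logPoly σ F w at h
  rw [sub_eq_iff_eq_add, expRemainder_add, hF.curve_eval_one] at h
  have h' := congrArg (MvPolynomial.aeval y) h
  rw [map_aeval, MvPolynomial.aeval_X] at h'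
  rw [hF.expMap_apply, hF.curve_eval_one]
  exact h'.symm

theorem IsHomogeneousLaw.expMap_bijective [CharZero k] (hF : IsHomogeneousLaw σ F) :
    Function.Bijective (expMap F) :=
  ⟨hF.expMap_injective, fun y => ⟨_, hF.expMap_logPoly y⟩⟩

theorem IsHomogeneousLaw.leftInverse_logMap [CharZero k] (hF : IsHomogeneousLaw σ F) :
    Function.LeftInverse (logMap F) (expMap F) :=
  Function.leftInverse_invFun hF.expMap_injective

theorem IsHomogeneousLaw.rightInverse_logMap [CharZero k] (hF : IsHomogeneousLaw σ F) :
    Function.RightInverse (logMap F) (expMap F) :=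
  Function.rightInverse_invFun hF.expMap_bijective.2

theorem IsHomogeneousLaw.logMap_apply [CharZero k] (hF : IsHomogeneousLaw σ F) (y : W → k) :
    logMap F y = fun w => MvPolynomial.eval y (logPoly σ F w) := by
  conv_lhs => rw [← hF.expMap_logPoly y]
  exact hF.leftInverse_logMap _

/-! ### Homogeneity of the exponential and the logarithm -/

/-- The polynomials in `t` whose coefficients are weighted homogeneous of degree `d`. -/
def homogeneousCoeff (k : Type*) {W : Type*} [Field k] (σ : W → ℕ) (d : ℕ) :
    Submodule k (Polynomial (MvPolynomial W k)) where
  carrier := {p | ∀ i, p.coeff i ∈ MvPolynomial.weightedHomogeneousSubmodule k σ d}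
  add_mem' hp hq i := by
    rw [Polynomial.coeff_add]
    exact Submodule.add_mem _ (hp i) (hq i)
  zero_mem' i := by
    rw [Polynomial.coeff_zero]
    exact Submodule.zero_mem _
  smul_mem' c p hp i := by
    rw [Polynomial.coeff_smul]
    exact Submodule.smul_mem _ _ (hp i)

instance gradedMonoid_homogeneousCoeff (σ : W → ℕ) :
    SetLike.GradedMonoid (homogeneousCoeff k σ) where
  one_mem i := by
    rw [Polynomial.coeff_one]
    split_ifs
    · exact MvPolynomial.isWeightedHomogeneous_one k σ
    · exact Submodule.zero_mem _
  mul_mem d e p q hp hq i := by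
    rw [Polynomial.coeff_mul]
    exact Submodule.sum_mem _ fun j _ => MvPolynomial.IsWeightedHomogeneous.mul (hp _) (hq _)

theorem IsHomogeneousLaw.curve_mem [CharZero k] (hF : IsHomogeneousLaw σ F) (w : W) :
    curve σ F (MvPolynomial.X : W → MvPolynomial W k) w ∈ homogeneousCoeff k σ (σ w) := by
  classical
  refine triangularFix_induction (fun w p => p ∈ homogeneousCoeff k σ (σ w))
    (fun w => Submodule.zero_mem _) (fun γ hγ w => ?_) w
  have key : ∑ u, Polynomial.C (MvPolynomial.X u) * MvPolynomial.aeval γ (jacobian F w u) ∈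
      homogeneousCoeff k σ (σ w) := by
    refine Submodule.sum_mem _ fun u _ => ?_
    have hX : Polynomial.C (MvPolynomial.X u) ∈ homogeneousCoeff k σ (σ u) := fun i => by
      rw [Polynomial.coeff_C]
      split_ifs
      · exact MvPolynomial.isWeightedHomogeneous_X k σ u
      · exact Submodule.zero_mem _
    -- For `σ u ≤ σ w` the factors have degrees `σ u` and `σ w - σ u`. Otherwise this subtraction
    -- would truncate, but then the Jacobian entry is zero.
    by_cases hu : σ u ≤ σ w
    · have h1 := (hF.homogeneous w).pderiv (i := Sum.inr u) (n' := σ w - σ u)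
        (by simp [Nat.sub_add_cancel hu])
      have h2 := aeval_mem_graded (homogeneousCoeff k σ) h1 (g := Sum.elim γ 0) (fun i => by
        obtain i | i := i
        · exact hγ i
        · exact Submodule.zero_mem _)
      rw [← aeval_jacobian] at h2
      have := SetLike.mul_mem_graded hX h2
      rwa [Nat.add_sub_cancel' hu] at this
    · rw [hF.aeval_jacobian_of_le (by omega), if_neg (by rintro rfl; exact hu le_rfl), mul_zero]
      exact Submodule.zero_mem _
  intro i
  obtain _ | i := i
  · rw [picard, coeff_antideriv_zero]
    exact Submodule.zero_mem _
  · rw [picard, coeff_antideriv_succ]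
    exact Submodule.smul_mem _ _ (key i)

theorem IsHomogeneousLaw.isWeightedHomogeneous_expPoly [CharZero k] (hF : IsHomogeneousLaw σ F)
    (w : W) : MvPolynomial.IsWeightedHomogeneous σ (expPoly σ F w) (σ w) := by
  rw [expPoly, Polynomial.eval_eq_sum, Polynomial.sum_def]
  refine MvPolynomial.IsWeightedHomogeneous.sum _ _ _ fun i _ => ?_
  rw [one_pow, mul_one]
  exact hF.curve_mem w i

theorem IsHomogeneousLaw.isWeightedHomogeneous_logPoly [CharZero k] (hF : IsHomogeneousLaw σ F)
    (w : W) : MvPolynomial.IsWeightedHomogeneous σ (logPoly σ F w) (σ w) := by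
  refine triangularFix_induction (fun w p => MvPolynomial.IsWeightedHomogeneous σ p (σ w))
    (fun w => MvPolynomial.isWeightedHomogeneous_zero k σ _) (fun x hx w => ?_) w
  rw [Pi.sub_apply, expRemainder, hF.curve_eval_one]
  exact (MvPolynomial.isWeightedHomogeneous_X k σ w).sub
    ((aeval_isWeightedHomogeneous (hF.isWeightedHomogeneous_expPoly w) hx).sub (hx w))

theorem IsHomogeneousLaw.isHomogeneousPolynomialMap_expMap [CharZero k]
    (hF : IsHomogeneousLaw σ F) : IsHomogeneousPolynomialMap σ (expMap F) :=
  ⟨expPoly σ F, hF.isWeightedHomogeneous_expPoly, fun x w => by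
    rw [hF.expMap_apply, hF.curve_eval_one]
    rfl⟩

theorem IsHomogeneousLaw.isHomogeneousPolynomialMap_logMap [CharZero k]
    (hF : IsHomogeneousLaw σ F) : IsHomogeneousPolynomialMap σ (logMap F) :=
  ⟨logPoly σ F, hF.isWeightedHomogeneous_logPoly, fun x w => by rw [hF.logMap_apply]⟩

/-! ### The exponential is a homomorphism -/

/-- By the chain rule, the derivative of the product has one part for each factor. Left invariance
turns the part from `δ` into the field of `v` at the product point, and commutativity does the same
for `γ` and `u`. -/
theorem IsHomogeneousLaw.isIntegralCurve_polyOp [CharZero k] (hF : IsHomogeneousLaw σ F)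
    {u v : W → k} {γ δ : W → Polynomial k} (hγ : IsIntegralCurve F u γ)
    (hδ : IsIntegralCurve F v δ) : IsIntegralCurve F (u + v) (polyOp F γ δ) := by
  refine ⟨fun w => ?_, fun w => ?_⟩
  · have h := congrFun (map_polyOp F (Polynomial.aeval (R := k) (0 : k)) γ δ) w
    rw [show Polynomial.aeval (0 : k) ∘ γ = 0 from funext fun u => hγ.1 u,
      show Polynomial.aeval (0 : k) ∘ δ = 0 from funext fun u => hδ.1 u, hF.polyOp_zero] at h
    exact h
  -- Stated for arbitrary curves so that it also applies with the two factors exchanged.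
  · have half : ∀ {v : W → k} {γ δ : W → Polynomial k}, IsIntegralCurve F v δ →
        ∑ t, MvPolynomial.aeval (Sum.elim γ δ) (MvPolynomial.pderiv (Sum.inr t) (F w)) *
          Polynomial.derivative (δ t) =
        ∑ t, Polynomial.C (v t) * MvPolynomial.aeval (polyOp F γ δ) (jacobian F w t) := by
      intro v γ δ hδ
      simp only [hδ.2, ← hF.sum_pderiv_mul_jacobian, Finset.mul_sum]
      rw [Finset.sum_comm]
      exact Finset.sum_congr rfl fun _ _ => Finset.sum_congr rfl fun _ _ => mul_left_comm _ _ _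
    have h := derivation_aeval (Polynomial.derivative' (R := k)) (Sum.elim γ δ) (F w)
    rw [Fintype.sum_sum_type] at h
    simp only [Sum.elim_inl, Sum.elim_inr, Polynomial.derivative'_apply, hF.aeval_pderiv_inl] at h
    rw [half hγ, half hδ, hF.polyOp_comm δ γ, ← Finset.sum_add_distrib] at h
    rw [polyOp, h]
    exact Finset.sum_congr rfl fun t _ => by rw [Pi.add_apply, map_add, add_mul]

theorem IsHomogeneousLaw.expMap_add [CharZero k] (hF : IsHomogeneousLaw σ F) (u v : W → k) :
    expMap F (u + v) = polyOp F (expMap F u) (expMap F v) := by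
  have hc : ∀ v : W → k, IsIntegralCurve F v (curve σ F v) := fun v =>
    (isIntegralCurve_iff F v _).2 (hF.picard_curve v)
  have he : ∀ v : W → k, expMap F v = Polynomial.aeval (1 : k) ∘ curve σ F v := fun v =>
    funext (hF.expMap_apply v)
  rw [he, he, he, ← map_polyOp, (hF.existsUnique_isIntegralCurve (u + v)).unique (hc (u + v))
    (hF.isIntegralCurve_polyOp (hc u) (hc v))]

theorem IsHomogeneousLaw.expMap_zero [CharZero k] (hF : IsHomogeneousLaw σ F) :
    expMap F 0 = 0 := by
  have h : IsIntegralCurve F 0 0 := ⟨fun w => by simp, fun w => by simp⟩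
  funext w
  rw [hF.expMap_apply, (hF.existsUnique_isIntegralCurve 0).unique
    ((isIntegralCurve_iff F 0 _).2 (hF.picard_curve 0)) h]
  simp

theorem IsHomogeneousLaw.isGroupIso_expMap [CharZero k] (hF : IsHomogeneousLaw σ F) :
    IsGroupIso (fun x y => x + y) (polyOp F) (expMap F) :=
  ⟨hF.expMap_bijective, hF.expMap_add⟩

theorem IsHomogeneousLaw.isGroupIso_logMap [CharZero k] (hF : IsHomogeneousLaw σ F) :
    IsGroupIso (polyOp F) (fun x y => x + y) (logMap F) := by
  refine ⟨⟨hF.rightInverse_logMap.injective, hF.leftInverse_logMap.surjective⟩, fun x y => ?_⟩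
  change _ = logMap F x + logMap F y
  rw [← hF.leftInverse_logMap (logMap F x + logMap F y), hF.expMap_add, hF.rightInverse_logMap,
    hF.rightInverse_logMap]

/-- Inverses are not part of the law; they come from negation in the additive group through the
exponential. -/
theorem IsHomogeneousLaw.isAbelianGroup [CharZero k] (hF : IsHomogeneousLaw σ F) :
    IsAbelianGroup (polyOp F : (W → k) → (W → k) → W → k) 0 where
  assoc := hF.assoc
  comm := hF.comm
  unit := hF.zero
  inverse x := ⟨expMap F (-logMap F x), by
    have h := hF.expMap_add (logMap F x) (-logMap F x)
    rwa [hF.rightInverse_logMap, add_neg_cancel, hF.expMap_zero, eq_comm] at h⟩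

end Curves

/-! ### Application to the three convolution groups -/

theorem IsGroupIso.comp {G H K : Type*} {op₁ : G → G → G} {op₂ : H → H → H} {op₃ : K → K → K}
    {ψ : H → K} {φ : G → H} (hψ : IsGroupIso op₂ op₃ ψ) (hφ : IsGroupIso op₁ op₂ φ) :
    IsGroupIso op₁ op₃ (ψ ∘ φ) :=
  ⟨hψ.1.comp hφ.1, fun x y => by simp only [Function.comp_apply, hφ.2, hψ.2]⟩

theorem polyOp_groupLaw (k : Type*) [Field k] (ι : Independence) (s n : ℕ) :
    (polyOp (groupLaw k ι s n) : (Word s n → k) → _ → _) = conv ι := by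
  funext f g w
  exact eval_groupLaw ι f g w

/-- The bridge between the two halves: the choice of independence enters the theory of the
exponential only through these properties. -/
theorem isHomogeneousLaw_groupLaw (k : Type*) [Field k] (ι : Independence) (s n : ℕ) :
    IsHomogeneousLaw deg (groupLaw k ι s n) where
  pos w := List.length_pos_of_ne_nil w.2.1
  homogeneous := isWeightedHomogeneous_groupLaw k ι
  comm x y := by rw [polyOp_groupLaw, conv_comm]
  assoc x y z := by simp only [polyOp_groupLaw, conv_assoc]
  zero x := by rw [polyOp_groupLaw, conv_zero]

end MomentConvolution

theorem mainTheorem7 (k : Type*) [Field k] [CharZero k] (s n : ℕ) :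
    (∀ i : MomentConvolution.Independence,
      -- `(k^N, ⋆_i, 0)` is an abelian group given by the polynomial group law
      MomentConvolution.IsAbelianGroup
        (MomentConvolution.conv i : (MomentConvolution.Word s n → k) → _ → _) 0 ∧
      (∀ (f g : MomentConvolution.Word s n → k) (w : MomentConvolution.Word s n),
        MvPolynomial.eval (Sum.elim f g) (MomentConvolution.groupLaw k i s n w) =
          MomentConvolution.conv i f g w) ∧
      -- it is homogeneous with weights `deg w`
      (∀ w : MomentConvolution.Word s n,
        MvPolynomial.IsWeightedHomogeneous
          (Sum.elim MomentConvolution.deg MomentConvolution.deg)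
          (MomentConvolution.groupLaw k i s n w) (MomentConvolution.deg w)) ∧
      MomentConvolution.IsHomogeneousGroup (k := k)
        (MomentConvolution.deg : MomentConvolution.Word s n → ℕ) (MomentConvolution.conv i) ∧
      -- `EXP_i` and `LOG_i` are well defined and mutually inverse
      (∀ v : MomentConvolution.Word s n → k,
        ∃! γ, MomentConvolution.IsIntegralCurve (MomentConvolution.groupLaw k i s n) v γ) ∧
      Function.LeftInverse
        (MomentConvolution.LOG i : (MomentConvolution.Word s n → k) → _)
        (MomentConvolution.EXP i) ∧
      Function.RightInverse
        (MomentConvolution.LOG i : (MomentConvolution.Word s n → k) → _)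
        (MomentConvolution.EXP i) ∧
      -- they are homogeneous polynomial isomorphisms with `(k^N, +, 0)`
      MomentConvolution.IsGroupIso
        (MomentConvolution.conv i) (fun x y => x + y)
        (MomentConvolution.LOG i : (MomentConvolution.Word s n → k) → _) ∧
      MomentConvolution.IsGroupIso
        (fun x y => x + y) (MomentConvolution.conv i)
        (MomentConvolution.EXP i : (MomentConvolution.Word s n → k) → _) ∧
      MomentConvolution.IsHomogeneousPolynomialMap MomentConvolution.deg
        (MomentConvolution.LOG i : (MomentConvolution.Word s n → k) → _) ∧
      MomentConvolution.IsHomogeneousPolynomialMap MomentConvolution.deg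
        (MomentConvolution.EXP i : (MomentConvolution.Word s n → k) → _)) ∧
    -- the isomorphisms between the three groups
    (∀ i j : MomentConvolution.Independence,
      MomentConvolution.IsGroupIso
        (MomentConvolution.conv i) (MomentConvolution.conv j)
        (MomentConvolution.EXP j ∘ MomentConvolution.LOG i :
          (MomentConvolution.Word s n → k) → MomentConvolution.Word s n → k) ∧
      MomentConvolution.IsHomogeneousPolynomialMap MomentConvolution.deg
        (MomentConvolution.EXP j ∘ MomentConvolution.LOG i :
          (MomentConvolution.Word s n → k) → MomentConvolution.Word s n → k) ∧
      (MomentConvolution.LOG j ∘ (MomentConvolution.EXP j ∘ MomentConvolution.LOG i) :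
          (MomentConvolution.Word s n → k) → MomentConvolution.Word s n → k) =
        MomentConvolution.LOG i) := by
  have hF := fun i => MomentConvolution.isHomogeneousLaw_groupLaw k i s n
  have hop := fun i => MomentConvolution.polyOp_groupLaw k i s n
  have hlog : ∀ i, MomentConvolution.IsGroupIso (MomentConvolution.conv i) (fun x y => x + y)
      (MomentConvolution.LOG i : (MomentConvolution.Word s n → k) → _) := fun i => by
    rw [← hop i]
    exact (hF i).isGroupIso_logMap
  have hexp : ∀ i, MomentConvolution.IsGroupIso (fun x y => x + y) (MomentConvolution.conv i)
      (MomentConvolution.EXP i : (MomentConvolution.Word s n → k) → _) := fun i => by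
    rw [← hop i]
    exact (hF i).isGroupIso_expMap
  refine ⟨fun i => ⟨hop i ▸ (hF i).isAbelianGroup, MomentConvolution.eval_groupLaw i,
    (hF i).homogeneous, hop i ▸ (hF i).isHomogeneousGroup, (hF i).existsUnique_isIntegralCurve,
    (hF i).leftInverse_logMap, (hF i).rightInverse_logMap, hlog i, hexp i,
    (hF i).isHomogeneousPolynomialMap_logMap, (hF i).isHomogeneousPolynomialMap_expMap⟩,
    fun i j => ⟨(hexp j).comp (hlog i),
      (hF j).isHomogeneousPolynomialMap_expMap.comp (hF i).isHomogeneousPolynomialMap_logMap,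
      funext fun x => (hF j).leftInverse_logMap _⟩⟩
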